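/- Algebras are associative complex algebras, not necessarily unital. For algebras $A_1,A_2$ let $A_1\sqcup A_2$ be their free product (the coproduct of algebras, as a vector space the direct sum of all alternating tensor products of $A_1$ and $A_2$), with embeddings $i_1,i_2$; for algebra homomorphisms $j_k$ write $j_1\sqcup j_2$ for the homomorphism on $A_1\sqcup A_2$ determined by $j_1, j_2$ (common target), and $j_1\amalg j_2=(i_1\circ j_1)\sqcup(i_2\circ j_2)$. A $\odot$-independence assigns to every pair of linear functionals $\phi_k:A_k\to\mathbb C$ a linear functional $\phi_1\odot\phi_2$ on $A_1\sqcup A_2$ such that $(\phi_1\odot\phi_2)\circ i_k=\phi_k$ for $k=1,2$, $(\phi_1\odot\phi_2)\odot\phi_3=\phi_1\odot(\phi_2\odot\phi_3)$, and $(\phi_1\circ j_1)\odot(\phi_2\circ j_2)=(\phi_1\odot\phi_2)\circ(j_1\amalg j_2)$ for all algebra homomorphisms $j_1,j_2$. Fix a $\odot$-independence. A dual semigroup is a $*$-algebra $B$ with a $*$-homomorphism $\Delta:B\to B\sqcup B$ such that $(\Delta\amalg\mathrm{id})\circ\Delta=(\mathrm{id}\amalg\Delta)\circ\Delta$ and $(0\sqcup\mathrm{id})\circ\Delta=\mathrm{id}=(\mathrm{id}\sqcup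 0)\circ\Delta$. For linear functionals on $B$ put $\phi_1\star_\Delta\phi_2=(\phi_1\odot\phi_2)\circ\Delta$. Let $S(B)$ be the (unital) symmetric algebra over $B$, with embedding $i:B\to S(B)$, and let $S(\phi):S(B)\to\mathbb C$ be the character extending a linear functional $\phi$. There is a unique linear map $\sigma:B\sqcup B\to S(B)\otimes S(B)$ with $\phi_1\odot\phi_2=(S(\phi_1)\otimes S(\phi_2))\circ\sigma$ for all $\phi_1,\phi_2$. Give $S(B)$ the comultiplication extending $\sigma\circ\Delta$ to an algebra homomorphism, and the counit $S(0)$. For a linear functional $\psi$ on $B$ let $D(\psi)(c)=\frac{d}{dt}S(t\psi)(c)|_{t=0}$ and $$\exp_{\star\Delta}\psi=\Bigl(\sum_{n\ge 0}\tfrac{1}{n!}D(\psi)^{\star n}\Bigr)\circ i ,$$ the series being pointwise convergent on $S(B)$. Let $T(B)=\bigoplus_{n\ge1}B^{\otimes n}$ be the tensor $*$-algebra over the $*$-vector space $B$, with embedding $i_B:B\to T(B)$. Let $T(\Delta):T(B)\to T(B)\sqcup T(B)$ be the homomorphism extending the linear map $(i_B\sqcup i_B)\circ\Delta$, where $i_B\sqcup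 i_B:B\sqcup B\to T(B)\sqcup T(B)$ is the linear map applying $i_B$ to each letter of an alternating tensor. Let $M:T(B)\to B$ be the multiplication map, $M(b_1\otimes\cdots\otimes b_n)=b_1\cdots b_n$. The convolution and the convolution exponential on $T(B)$ are formed in the same way with $T(\Delta)$ in place of $\Delta$. Then for all linear functionals $\phi_1,\phi_2,\psi$ on a dual semigroup $(B,\Delta)$: (a) $(\phi_1\circ M)\star_{T(\Delta)}(\phi_2\circ M)=(\phi_1\star_\Delta\phi_2)\circ M$; (b) $\exp_{\star\Delta}\psi$ and $\exp_{\star T(\Delta)}(\psi\circ M)$ are well defined, and $\exp_{\star T(\Delta)}(\psi\circ M)=(\exp_{\star\Delta}\psi)\circ M$; (c) $\ker M$ is a two-sided $*$-ideal of $T(B)$, and $\exp_{\star T(\Delta)}(\psi\circ M)$ vanishes on $\ker M$. -/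

import Mathlib

open scoped TensorProduct

universe u w

noncomputable section

namespace DualSemi

set_option linter.unusedSectionVars false

/-! ### Augmentation ideals as non-unital algebras -/

section Aug

variable {U : Type u} [Ring U] [Algebra ℂ U]

/-- The kernel of a character of a unital algebra, as a non-unital algebra. -/
def augKer (ε : U →ₐ[ℂ] ℂ) : NonUnitalSubalgebra ℂ U where
  carrier := {x | ε x = 0}
  add_mem' {x y} hx hy := by
    have hx' : ε x = 0 := hx
    have hy' : ε y = 0 := hy
    simp [hx', hy']
  zero_mem' := by simp
  mul_mem' {x y} hx _ := by
    have hx' : ε x = 0 := hx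
    simp [hx']
  smul_mem' c {x} hx := by
    have hx' : ε x = 0 := hx
    simp [hx']

variable {A : Type w} [NonUnitalRing A] [Module ℂ A] [IsScalarTower ℂ A A] [SMulCommClass ℂ A A]

/-- A unital homomorphism into the unitization of `A` restricts to a homomorphism from the
augmentation ideal into `A`. -/
def augLift (ε : U →ₐ[ℂ] ℂ) (F : U →ₐ[ℂ] Unitization ℂ A) (hF : ∀ x, (F x).fst = ε x) :
    augKer ε →ₙₐ[ℂ] A where
  toFun x := (F x.1).snd
  map_smul' c x := by simp
  map_zero' := by simp
  map_add' x y := by simp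
  map_mul' x y := by
    have hx : ε x.1 = 0 := x.2
    have hy : ε y.1 = 0 := y.2
    simp [hF, hx, hy]

end Aug

/-! ### The tensor algebra (without unit) of a vector space -/

section Tensor

variable (V : Type u) [AddCommGroup V] [Module ℂ V]

/-- The tensor algebra `T(V) = ⨁_{n ≥ 1} V^{⊗ n}`, the free (non-unital) algebra over the vector
space `V`, realized as the augmentation ideal of the unital tensor algebra. -/
def TAlg : Type u := augKer (TensorAlgebra.algebraMapInv : TensorAlgebra ℂ V →ₐ[ℂ] ℂ)

namespace TAlg

instance : NonUnitalRing (TAlg V) :=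
  inferInstanceAs (NonUnitalRing (augKer (TensorAlgebra.algebraMapInv : TensorAlgebra ℂ V →ₐ[ℂ] ℂ)))
instance : Module ℂ (TAlg V) :=
  inferInstanceAs (Module ℂ (augKer (TensorAlgebra.algebraMapInv : TensorAlgebra ℂ V →ₐ[ℂ] ℂ)))
instance : IsScalarTower ℂ (TAlg V) (TAlg V) :=
  inferInstanceAs (IsScalarTower ℂ
    (augKer (TensorAlgebra.algebraMapInv : TensorAlgebra ℂ V →ₐ[ℂ] ℂ))
    (augKer (TensorAlgebra.algebraMapInv : TensorAlgebra ℂ V →ₐ[ℂ] ℂ)))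
instance : SMulCommClass ℂ (TAlg V) (TAlg V) :=
  inferInstanceAs (SMulCommClass ℂ
    (augKer (TensorAlgebra.algebraMapInv : TensorAlgebra ℂ V →ₐ[ℂ] ℂ))
    (augKer (TensorAlgebra.algebraMapInv : TensorAlgebra ℂ V →ₐ[ℂ] ℂ)))

variable {V}

theorem algebraMapInv_ι (v : V) :
    (TensorAlgebra.algebraMapInv : TensorAlgebra ℂ V →ₐ[ℂ] ℂ) (TensorAlgebra.ι ℂ v) = 0 := by
  simp [TensorAlgebra.algebraMapInv]

/-- The natural embedding `i_V : V → T(V)`. -/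
def ι : V →ₗ[ℂ] TAlg V where
  toFun v := ⟨TensorAlgebra.ι ℂ v, algebraMapInv_ι v⟩
  map_add' x y := Subtype.ext (map_add _ x y)
  map_smul' c x := Subtype.ext (map_smul _ c x)

variable {A : Type w} [NonUnitalRing A] [Module ℂ A] [IsScalarTower ℂ A A] [SMulCommClass ℂ A A]

/-- The algebra homomorphism `T(k) : T(V) → A` extending the linear map `k : V → A`. -/
def lift (k : V →ₗ[ℂ] A) : TAlg V →ₙₐ[ℂ] A :=
  augLift _ (TensorAlgebra.lift ℂ ((Unitization.inrHom ℂ ℂ A) ∘ₗ k)) (fun x => by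
    have h : (Unitization.fstHom ℂ A).comp
        (TensorAlgebra.lift ℂ ((Unitization.inrHom ℂ ℂ A) ∘ₗ k)) = TensorAlgebra.algebraMapInv := by
      ext v
      simp [algebraMapInv_ι]
    exact DFunLike.congr_fun h x)

@[simp] theorem lift_ι (k : V →ₗ[ℂ] A) (v : V) : lift k (ι v) = k v := by
  change (TensorAlgebra.lift ℂ ((Unitization.inrHom ℂ ℂ A) ∘ₗ k) (TensorAlgebra.ι ℂ v) :
    Unitization ℂ A).snd = k v
  simp

end TAlg

end Tensor

/-! ### The involution of the tensor algebra over a `*`-vector space -/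

section TensorStar

/-- The opposite of a complex algebra, with complex conjugate scalar multiplication. -/
def ConjOp (U : Type u) : Type u := Uᵐᵒᵖ

variable (U : Type u) [Ring U] [Algebra ℂ U]

instance : Ring (ConjOp U) := inferInstanceAs (Ring Uᵐᵒᵖ)

instance : Algebra ℂ (ConjOp U) :=
  RingHom.toAlgebra' (S := ConjOp U)
    ((algebraMap ℂ Uᵐᵒᵖ).comp (starRingEnd ℂ))
    (fun c x => Algebra.commutes (A := Uᵐᵒᵖ) (star c) x)

variable {V : Type u} [AddCommGroup V] [Module ℂ V] [StarAddMonoid V] [StarModule ℂ V]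

variable {U} in
/-- The identity map `U → ConjOp U`. -/
def ConjOp.mk (x : U) : ConjOp U := (MulOpposite.op x : Uᵐᵒᵖ)

theorem ConjOp.smul_mk (c : ℂ) (x : U) : c • ConjOp.mk x = ConjOp.mk (star c • x) := by
  rw [Algebra.smul_def]
  change (algebraMap ℂ Uᵐᵒᵖ (star c) * MulOpposite.op x : Uᵐᵒᵖ) = MulOpposite.op (star c • x)
  rw [← Algebra.smul_def]
  rfl

/-- `v ↦ v*`, as a linear map into the conjugate opposite of the tensor algebra. -/
def tensorConj₀ : V →ₗ[ℂ] ConjOp (TensorAlgebra ℂ V) where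
  toFun v := ConjOp.mk (TensorAlgebra.ι ℂ (star v))
  map_add' x y := by
    rw [star_add, map_add]
    rfl
  map_smul' c x := by
    rw [RingHom.id_apply, ConjOp.smul_mk, star_smul, map_smul]

/-- The antilinear antihomomorphism of the unital tensor algebra extending `v ↦ v*`. -/
def tensorConj : TensorAlgebra ℂ V →+* (TensorAlgebra ℂ V)ᵐᵒᵖ :=
  (TensorAlgebra.lift ℂ (tensorConj₀ (V := V))).toRingHom

theorem tensorConj_ι (v : V) :
    tensorConj (TensorAlgebra.ι ℂ v) = MulOpposite.op (TensorAlgebra.ι ℂ (star v)) :=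
  TensorAlgebra.lift_ι_apply (tensorConj₀ (V := V)) v

theorem tensorConj_algebraMap (c : ℂ) :
    tensorConj (V := V) (algebraMap ℂ _ c) = MulOpposite.op (algebraMap ℂ _ (star c)) :=
  (TensorAlgebra.lift ℂ (tensorConj₀ (V := V))).commutes c

/-- The involution `(v₁ ⊗ ⋯ ⊗ vₙ)* = vₙ* ⊗ ⋯ ⊗ v₁*` on the unital tensor algebra. -/
def tensorStar (x : TensorAlgebra ℂ V) : TensorAlgebra ℂ V := (tensorConj x).unop

theorem tensorStar_ι (v : V) :
    tensorStar (TensorAlgebra.ι ℂ v) = TensorAlgebra.ι ℂ (star v) := by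
  simp [tensorStar, tensorConj_ι]

theorem tensorStar_algebraMap (c : ℂ) :
    tensorStar (V := V) (algebraMap ℂ _ c) = algebraMap ℂ _ (star c) := by
  simp [tensorStar, tensorConj_algebraMap]

theorem tensorStar_add (x y : TensorAlgebra ℂ V) :
    tensorStar (x + y) = tensorStar x + tensorStar y := by simp [tensorStar]

theorem tensorStar_mul (x y : TensorAlgebra ℂ V) :
    tensorStar (x * y) = tensorStar y * tensorStar x := by simp [tensorStar]

theorem tensorStar_tensorStar (x : TensorAlgebra ℂ V) : tensorStar (tensorStar x) = x := by
  induction x using TensorAlgebra.induction with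
  | algebraMap r => simp [tensorStar_algebraMap]
  | ι v => simp [tensorStar_ι]
  | mul a b ha hb => simp [tensorStar_mul, ha, hb]
  | add a b ha hb => simp [tensorStar_add, ha, hb]

theorem algebraMapInv_tensorStar (x : TensorAlgebra ℂ V) :
    TensorAlgebra.algebraMapInv (tensorStar x) = star (TensorAlgebra.algebraMapInv x : ℂ) := by
  induction x using TensorAlgebra.induction with
  | algebraMap r => simp [tensorStar_algebraMap]
  | ι v => simp [tensorStar_ι, TAlg.algebraMapInv_ι]
  | mul a b ha hb => simp [tensorStar_mul, ha, hb, mul_comm]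
  | add a b ha hb => simp [tensorStar_add, ha, hb]

instance : StarRing (TAlg V) where
  star x := ⟨tensorStar x.1, by
    have hx : TensorAlgebra.algebraMapInv x.1 = (0 : ℂ) := x.2
    change TensorAlgebra.algebraMapInv (tensorStar x.1) = (0 : ℂ)
    rw [algebraMapInv_tensorStar, hx, star_zero]⟩
  star_involutive x := Subtype.ext (tensorStar_tensorStar x.1)
  star_mul x y := Subtype.ext (tensorStar_mul x.1 y.1)
  star_add x y := Subtype.ext (tensorStar_add x.1 y.1)

instance : StarModule ℂ (TAlg V) where
  star_smul c x := Subtype.ext (by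
    change tensorStar (c • x.1) = star c • tensorStar x.1
    rw [Algebra.smul_def, tensorStar_mul, tensorStar_algebraMap, Algebra.smul_def,
      Algebra.commutes])

theorem TAlg.star_ι (v : V) : star (TAlg.ι v) = TAlg.ι (star v) := Subtype.ext (tensorStar_ι v)

end TensorStar

/-! ### The free product of algebras -/

section FreeProduct

variable (A₁ A₂ : Type u)
  [NonUnitalRing A₁] [Module ℂ A₁] [IsScalarTower ℂ A₁ A₁] [SMulCommClass ℂ A₁ A₁]
  [NonUnitalRing A₂] [Module ℂ A₂] [IsScalarTower ℂ A₂ A₂] [SMulCommClass ℂ A₂ A₂]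

/-- The relations identifying the product of two letters from the same algebra with the letter
which is their product in this algebra. -/
inductive FreeProd.Rel : TensorAlgebra ℂ (A₁ × A₂) → TensorAlgebra ℂ (A₁ × A₂) → Prop
  | left (a a' : A₁) : FreeProd.Rel
      (TensorAlgebra.ι ℂ ((a, 0) : A₁ × A₂) * TensorAlgebra.ι ℂ ((a', 0) : A₁ × A₂))
      (TensorAlgebra.ι ℂ ((a * a', 0) : A₁ × A₂))
  | right (b b' : A₂) : FreeProd.Rel
      (TensorAlgebra.ι ℂ ((0, b) : A₁ × A₂) * TensorAlgebra.ι ℂ ((0, b') : A₁ × A₂))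
      (TensorAlgebra.ι ℂ ((0, b * b') : A₁ × A₂))

/-- The free product of `A₁` and `A₂` with a unit adjoined. -/
abbrev UFreeProd : Type u := RingQuot (FreeProd.Rel A₁ A₂)

variable {A₁ A₂}

/-- Universal property of the free product with a unit adjoined. -/
def UFreeProd.lift {U : Type w} [Ring U] [Algebra ℂ U] (f : A₁ →ₙₐ[ℂ] U) (g : A₂ →ₙₐ[ℂ] U) :
    UFreeProd A₁ A₂ →ₐ[ℂ] U :=
  RingQuot.liftAlgHom ℂ ⟨TensorAlgebra.lift ℂ
    (LinearMap.coprod (f : A₁ →ₗ[ℂ] U) (g : A₂ →ₗ[ℂ] U)), by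
      intro x y h
      cases h <;> simp⟩

variable (A₁ A₂)

/-- The character of the free product with a unit adjoined which vanishes on `A₁` and `A₂`. -/
def UFreeProd.counit : UFreeProd A₁ A₂ →ₐ[ℂ] ℂ := UFreeProd.lift 0 0

/-- The free product `A₁ ⊔ A₂` of two algebras, that is, the coproduct in the category of
(associative, not necessarily unital) complex algebras. -/
def FreeProd : Type u := augKer (UFreeProd.counit A₁ A₂)

namespace FreeProd

instance : NonUnitalRing (FreeProd A₁ A₂) :=
  inferInstanceAs (NonUnitalRing (augKer (UFreeProd.counit A₁ A₂)))
instance : Module ℂ (FreeProd A₁ A₂) :=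
  inferInstanceAs (Module ℂ (augKer (UFreeProd.counit A₁ A₂)))
instance : IsScalarTower ℂ (FreeProd A₁ A₂) (FreeProd A₁ A₂) :=
  inferInstanceAs (IsScalarTower ℂ (augKer (UFreeProd.counit A₁ A₂))
    (augKer (UFreeProd.counit A₁ A₂)))
instance : SMulCommClass ℂ (FreeProd A₁ A₂) (FreeProd A₁ A₂) :=
  inferInstanceAs (SMulCommClass ℂ (augKer (UFreeProd.counit A₁ A₂))
    (augKer (UFreeProd.counit A₁ A₂)))

variable {A₁ A₂}

/-- The image of a pair `(a, b)`, standing for `i₁(a) + i₂(b)`, in the free product with a unit. -/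
def letter : A₁ × A₂ →ₗ[ℂ] UFreeProd A₁ A₂ :=
  (RingQuot.mkAlgHom ℂ (FreeProd.Rel A₁ A₂)).toLinearMap ∘ₗ TensorAlgebra.ι ℂ

theorem _root_.DualSemi.UFreeProd.lift_letter {U : Type w} [Ring U] [Algebra ℂ U]
    (f : A₁ →ₙₐ[ℂ] U) (g : A₂ →ₙₐ[ℂ] U) (p : A₁ × A₂) :
    UFreeProd.lift f g (letter p) = f p.1 + g p.2 := by
  simp [UFreeProd.lift, letter]

theorem counit_letter (p : A₁ × A₂) : UFreeProd.counit A₁ A₂ (letter p) = 0 := by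
  simp [UFreeProd.counit, UFreeProd.lift_letter]

theorem letter_mul_left (a a' : A₁) :
    letter ((a, 0) : A₁ × A₂) * letter ((a', 0) : A₁ × A₂) = letter (a * a', 0) := by
  have h := RingQuot.mkAlgHom_rel ℂ (Rel.left (A₂ := A₂) a a')
  rw [map_mul] at h
  exact h

theorem letter_mul_right (b b' : A₂) :
    letter ((0, b) : A₁ × A₂) * letter ((0, b') : A₁ × A₂) = letter (0, b * b') := by
  have h := RingQuot.mkAlgHom_rel ℂ (Rel.right (A₁ := A₁) b b')
  rw [map_mul] at h
  exact h

variable (A₁ A₂) in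
/-- The natural embedding `i₁ : A₁ → A₁ ⊔ A₂`. -/
def inl : A₁ →ₙₐ[ℂ] FreeProd A₁ A₂ where
  toFun a := ⟨letter (a, 0), counit_letter _⟩
  map_smul' c a := Subtype.ext (by
    change letter (c • a, (0 : A₂)) = c • letter (a, (0 : A₂))
    rw [← map_smul, Prod.smul_mk, smul_zero])
  map_zero' := Subtype.ext (map_zero letter)
  map_add' a a' := Subtype.ext (by
    change letter (a + a', (0 : A₂)) = letter (a, (0 : A₂)) + letter (a', (0 : A₂))
    rw [← map_add, Prod.mk_add_mk, add_zero])
  map_mul' a a' := Subtype.ext (letter_mul_left a a').symm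

variable (A₁ A₂) in
/-- The natural embedding `i₂ : A₂ → A₁ ⊔ A₂`. -/
def inr : A₂ →ₙₐ[ℂ] FreeProd A₁ A₂ where
  toFun b := ⟨letter (0, b), counit_letter _⟩
  map_smul' c b := Subtype.ext (by
    change letter ((0 : A₁), c • b) = c • letter ((0 : A₁), b)
    rw [← map_smul, Prod.smul_mk, smul_zero])
  map_zero' := Subtype.ext (map_zero letter)
  map_add' b b' := Subtype.ext (by
    change letter ((0 : A₁), b + b') = letter ((0 : A₁), b) + letter ((0 : A₁), b')
    rw [← map_add, Prod.mk_add_mk, add_zero])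
  map_mul' b b' := Subtype.ext (letter_mul_right b b').symm

variable {C : Type w} [NonUnitalRing C] [Module ℂ C] [IsScalarTower ℂ C C] [SMulCommClass ℂ C C]

/-- The homomorphism `j₁ ⊔ j₂ : A₁ ⊔ A₂ → C` given by the universal property. -/
def lift (j₁ : A₁ →ₙₐ[ℂ] C) (j₂ : A₂ →ₙₐ[ℂ] C) : FreeProd A₁ A₂ →ₙₐ[ℂ] C :=
  augLift _
    (UFreeProd.lift ((Unitization.inrNonUnitalAlgHom ℂ C).comp j₁)
      ((Unitization.inrNonUnitalAlgHom ℂ C).comp j₂)) (fun x => by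
    have h : (Unitization.fstHom ℂ C).comp
        (UFreeProd.lift ((Unitization.inrNonUnitalAlgHom ℂ C).comp j₁)
          ((Unitization.inrNonUnitalAlgHom ℂ C).comp j₂)) = UFreeProd.counit A₁ A₂ := by
      apply RingQuot.ringQuot_ext'
      apply TensorAlgebra.hom_ext
      apply LinearMap.ext
      intro p
      change (UFreeProd.lift _ _ (letter p) : Unitization ℂ C).fst = UFreeProd.counit A₁ A₂ (letter p)
      rw [counit_letter, UFreeProd.lift_letter]
      simp
    exact DFunLike.congr_fun h x)

@[simp] theorem lift_inl (j₁ : A₁ →ₙₐ[ℂ] C) (j₂ : A₂ →ₙₐ[ℂ] C) (a : A₁) :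
    lift j₁ j₂ (inl A₁ A₂ a) = j₁ a := by
  change (UFreeProd.lift _ _ (letter (a, 0)) : Unitization ℂ C).snd = _
  rw [UFreeProd.lift_letter]
  simp

@[simp] theorem lift_inr (j₁ : A₁ →ₙₐ[ℂ] C) (j₂ : A₂ →ₙₐ[ℂ] C) (b : A₂) :
    lift j₁ j₂ (inr A₁ A₂ b) = j₂ b := by
  change (UFreeProd.lift _ _ (letter (0, b)) : Unitization ℂ C).snd = _
  rw [UFreeProd.lift_letter]
  simp

/-- Every element of the free product with a unit is a scalar plus an element of the subalgebra
generated by the letters. -/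
theorem exists_scalar_add (x : UFreeProd A₁ A₂) :
    ∃ (c : ℂ) (y : FreeProd A₁ A₂),
      y ∈ NonUnitalAlgebra.adjoin ℂ (Set.range (inl A₁ A₂) ∪ Set.range (inr A₁ A₂)) ∧
        x = algebraMap ℂ _ c + y.1 := by
  obtain ⟨t, rfl⟩ := RingQuot.mkAlgHom_surjective ℂ (FreeProd.Rel A₁ A₂) x
  induction t using TensorAlgebra.induction with
  | algebraMap r => exact ⟨r, 0, zero_mem _, by
      rw [AlgHom.commutes]
      exact (add_zero _).symm⟩
  | ι p =>
    refine ⟨0, inl A₁ A₂ p.1 + inr A₁ A₂ p.2,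
      add_mem (NonUnitalAlgebra.subset_adjoin ℂ (Or.inl ⟨_, rfl⟩))
        (NonUnitalAlgebra.subset_adjoin ℂ (Or.inr ⟨_, rfl⟩)), ?_⟩
    rw [map_zero, zero_add]
    change letter p = letter (p.1, 0) + letter (0, p.2)
    rw [← map_add]
    simp
  | mul a b ha hb =>
    obtain ⟨c, y, hy, h⟩ := ha
    obtain ⟨d, z, hz, h'⟩ := hb
    refine ⟨c * d, c • z + d • y + y * z,
      add_mem (add_mem (SMulMemClass.smul_mem c hz) (SMulMemClass.smul_mem d hy))
        (mul_mem hy hz), ?_⟩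
    rw [map_mul, h, h']
    change _ = algebraMap ℂ _ (c * d) + (c • z.1 + d • y.1 + y.1 * z.1)
    rw [add_mul, mul_add, mul_add, ← Algebra.commutes d y.1, map_mul, Algebra.smul_def,
      Algebra.smul_def]
    abel
  | add a b ha hb =>
    obtain ⟨c, y, hy, h⟩ := ha
    obtain ⟨d, z, hz, h'⟩ := hb
    refine ⟨c + d, y + z, add_mem hy hz, ?_⟩
    rw [map_add, h, h']
    change _ = algebraMap ℂ _ (c + d) + (y.1 + z.1)
    rw [map_add]
    abel

/-- `A₁ ⊔ A₂` is generated by the images of `A₁` and `A₂`. -/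
theorem adjoin_eq_top :
    NonUnitalAlgebra.adjoin ℂ (Set.range (inl A₁ A₂) ∪ Set.range (inr A₁ A₂)) = ⊤ := by
  rw [eq_top_iff]
  intro x _
  obtain ⟨c, y, hy, h⟩ := exists_scalar_add x.1
  have hx : UFreeProd.counit A₁ A₂ x.1 = 0 := x.2
  have hy' : UFreeProd.counit A₁ A₂ y.1 = 0 := y.2
  rw [h, map_add, hy', AlgHom.commutes, add_zero] at hx
  have hc : c = 0 := hx
  rw [hc, map_zero, zero_add] at h
  rwa [show x = y from Subtype.ext h]

/-- Uniqueness in the universal property of the free product. -/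
theorem hom_ext {f g : FreeProd A₁ A₂ →ₙₐ[ℂ] C}
    (h₁ : ∀ a, f (inl A₁ A₂ a) = g (inl A₁ A₂ a)) (h₂ : ∀ b, f (inr A₁ A₂ b) = g (inr A₁ A₂ b)) :
    f = g := by
  refine NonUnitalAlgHom.ext fun x => ?_
  have hx : x ∈ NonUnitalAlgebra.adjoin ℂ (Set.range (inl A₁ A₂) ∪ Set.range (inr A₁ A₂)) := by
    rw [adjoin_eq_top]; trivial
  induction hx using NonUnitalAlgebra.adjoin_induction with
  | mem x hx =>
    rcases hx with ⟨a, rfl⟩ | ⟨b, rfl⟩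
    · exact h₁ a
    · exact h₂ b
  | add x y _ _ hx hy => rw [map_add, map_add, hx, hy]
  | zero => rw [map_zero, map_zero]
  | mul x y _ _ hx hy => rw [map_mul, map_mul, hx, hy]
  | smul r x _ hx => rw [map_smul, map_smul, hx]

end FreeProd

end FreeProduct

section FreeProductMaps

variable {A₁ A₂ A₃ C₁ C₂ : Type u}
  [NonUnitalRing A₁] [Module ℂ A₁] [IsScalarTower ℂ A₁ A₁] [SMulCommClass ℂ A₁ A₁]
  [NonUnitalRing A₂] [Module ℂ A₂] [IsScalarTower ℂ A₂ A₂] [SMulCommClass ℂ A₂ A₂]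
  [NonUnitalRing A₃] [Module ℂ A₃] [IsScalarTower ℂ A₃ A₃] [SMulCommClass ℂ A₃ A₃]
  [NonUnitalRing C₁] [Module ℂ C₁] [IsScalarTower ℂ C₁ C₁] [SMulCommClass ℂ C₁ C₁]
  [NonUnitalRing C₂] [Module ℂ C₂] [IsScalarTower ℂ C₂ C₂] [SMulCommClass ℂ C₂ C₂]

/-- The homomorphism `j₁ ∐ j₂ : A₁ ⊔ A₂ → C₁ ⊔ C₂`. -/
def FreeProd.map (j₁ : A₁ →ₙₐ[ℂ] C₁) (j₂ : A₂ →ₙₐ[ℂ] C₂) :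
    FreeProd A₁ A₂ →ₙₐ[ℂ] FreeProd C₁ C₂ :=
  FreeProd.lift ((FreeProd.inl C₁ C₂).comp j₁) ((FreeProd.inr C₁ C₂).comp j₂)

variable (A₁ A₂ A₃) in
/-- The natural identification `(A₁ ⊔ A₂) ⊔ A₃ → A₁ ⊔ (A₂ ⊔ A₃)`. -/
def FreeProd.assoc : FreeProd (FreeProd A₁ A₂) A₃ →ₙₐ[ℂ] FreeProd A₁ (FreeProd A₂ A₃) :=
  FreeProd.lift
    (FreeProd.lift (FreeProd.inl A₁ (FreeProd A₂ A₃))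
      ((FreeProd.inr A₁ (FreeProd A₂ A₃)).comp (FreeProd.inl A₂ A₃)))
    ((FreeProd.inr A₁ (FreeProd A₂ A₃)).comp (FreeProd.inr A₂ A₃))

end FreeProductMaps

/-! ### The involution of the free product of `*`-algebras -/

section FreeProductStar

variable {A₁ A₂ : Type u}
  [NonUnitalRing A₁] [Module ℂ A₁] [IsScalarTower ℂ A₁ A₁] [SMulCommClass ℂ A₁ A₁]
  [NonUnitalRing A₂] [Module ℂ A₂] [IsScalarTower ℂ A₂ A₂] [SMulCommClass ℂ A₂ A₂]
  [StarRing A₁] [StarModule ℂ A₁] [StarRing A₂] [StarModule ℂ A₂]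

/-- The involution of the tensor algebra, passed to the free product with a unit adjoined. -/
def UFreeProd.conj : UFreeProd A₁ A₂ →+* (UFreeProd A₁ A₂)ᵐᵒᵖ :=
  RingQuot.lift ⟨((RingQuot.mkRingHom (FreeProd.Rel A₁ A₂)).op).comp tensorConj, by
    intro x y h
    cases h with
    | left a a' =>
      have h := RingQuot.mkRingHom_rel (FreeProd.Rel.left (A₂ := A₂) (star a') (star a))
      simpa [tensorConj_ι, Prod.star_def] using congrArg MulOpposite.op h
    | right b b' =>
      have h := RingQuot.mkRingHom_rel (FreeProd.Rel.right (A₁ := A₁) (star b') (star b))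
      simpa [tensorConj_ι, Prod.star_def] using congrArg MulOpposite.op h⟩

/-- The involution of the free product with a unit adjoined. -/
def UFreeProd.starFun (x : UFreeProd A₁ A₂) : UFreeProd A₁ A₂ := (UFreeProd.conj x).unop

theorem UFreeProd.starFun_mk (t : TensorAlgebra ℂ (A₁ × A₂)) :
    UFreeProd.starFun (RingQuot.mkRingHom (FreeProd.Rel A₁ A₂) t)
      = RingQuot.mkRingHom (FreeProd.Rel A₁ A₂) (tensorStar t) := by
  simp [UFreeProd.starFun, UFreeProd.conj, tensorStar]

theorem UFreeProd.counit_mk (t : TensorAlgebra ℂ (A₁ × A₂)) :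
    UFreeProd.counit A₁ A₂ (RingQuot.mkRingHom (FreeProd.Rel A₁ A₂) t)
      = TensorAlgebra.algebraMapInv t := by
  have h : (UFreeProd.counit A₁ A₂).comp (RingQuot.mkAlgHom ℂ (FreeProd.Rel A₁ A₂))
      = TensorAlgebra.algebraMapInv := by
    apply TensorAlgebra.hom_ext
    apply LinearMap.ext
    intro p
    change UFreeProd.counit A₁ A₂ (FreeProd.letter p)
      = TensorAlgebra.algebraMapInv (TensorAlgebra.ι ℂ p)
    rw [FreeProd.counit_letter, TAlg.algebraMapInv_ι]
  rw [← h, ← RingQuot.mkAlgHom_coe ℂ]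
  rfl

theorem UFreeProd.starFun_starFun (x : UFreeProd A₁ A₂) :
    UFreeProd.starFun (UFreeProd.starFun x) = x := by
  obtain ⟨t, rfl⟩ := RingQuot.mkRingHom_surjective (FreeProd.Rel A₁ A₂) x
  rw [UFreeProd.starFun_mk, UFreeProd.starFun_mk, tensorStar_tensorStar]

theorem UFreeProd.counit_starFun (x : UFreeProd A₁ A₂) :
    UFreeProd.counit A₁ A₂ (UFreeProd.starFun x) = star (UFreeProd.counit A₁ A₂ x) := by
  obtain ⟨t, rfl⟩ := RingQuot.mkRingHom_surjective (FreeProd.Rel A₁ A₂) x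
  rw [UFreeProd.starFun_mk, UFreeProd.counit_mk, UFreeProd.counit_mk, algebraMapInv_tensorStar]

instance : StarRing (FreeProd A₁ A₂) where
  star x := ⟨UFreeProd.starFun x.1, by
    have hx : UFreeProd.counit A₁ A₂ x.1 = 0 := x.2
    change UFreeProd.counit A₁ A₂ (UFreeProd.starFun x.1) = 0
    rw [UFreeProd.counit_starFun, hx, star_zero]⟩
  star_involutive x := Subtype.ext (UFreeProd.starFun_starFun x.1)
  star_mul x y := Subtype.ext (by
    change UFreeProd.starFun (x.1 * y.1) = UFreeProd.starFun y.1 * UFreeProd.starFun x.1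
    simp [UFreeProd.starFun])
  star_add x y := Subtype.ext (by
    change UFreeProd.starFun (x.1 + y.1) = UFreeProd.starFun x.1 + UFreeProd.starFun y.1
    simp [UFreeProd.starFun])

instance : StarModule ℂ (FreeProd A₁ A₂) where
  star_smul c x := Subtype.ext (by
    change UFreeProd.starFun (c • x.1) = star c • UFreeProd.starFun x.1
    obtain ⟨t, ht⟩ := RingQuot.mkAlgHom_surjective ℂ (FreeProd.Rel A₁ A₂) x.1
    have e : ∀ s, RingQuot.mkAlgHom ℂ (FreeProd.Rel A₁ A₂) s
        = RingQuot.mkRingHom (FreeProd.Rel A₁ A₂) s := fun s => by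
      rw [← RingQuot.mkAlgHom_coe ℂ]; rfl
    rw [← ht, ← map_smul, e, e, UFreeProd.starFun_mk, UFreeProd.starFun_mk, ← e, ← e, ← map_smul,
      Algebra.smul_def, tensorStar_mul, tensorStar_algebraMap, Algebra.smul_def,
      Algebra.commutes])

theorem FreeProd.star_inl (a : A₁) :
    star (FreeProd.inl A₁ A₂ a) = FreeProd.inl A₁ A₂ (star a) := Subtype.ext (by
  change UFreeProd.starFun (FreeProd.letter (a, 0)) = FreeProd.letter (star a, 0)
  have h := UFreeProd.starFun_mk (TensorAlgebra.ι ℂ ((a, 0) : A₁ × A₂))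
  rw [tensorStar_ι, Prod.star_def, star_zero, ← RingQuot.mkAlgHom_coe ℂ] at h
  exact h)

theorem FreeProd.star_inr (b : A₂) :
    star (FreeProd.inr A₁ A₂ b) = FreeProd.inr A₁ A₂ (star b) := Subtype.ext (by
  change UFreeProd.starFun (FreeProd.letter (0, b)) = FreeProd.letter (0, star b)
  have h := UFreeProd.starFun_mk (TensorAlgebra.ι ℂ ((0, b) : A₁ × A₂))
  rw [tensorStar_ι, Prod.star_def, star_zero, ← RingQuot.mkAlgHom_coe ℂ] at h
  exact h)

end FreeProductStar

/-! ### Linear maps on a free product acting letter by letter -/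

section WordMap

variable {A₁ A₂ C : Type u}
  [NonUnitalRing A₁] [Module ℂ A₁] [IsScalarTower ℂ A₁ A₁] [SMulCommClass ℂ A₁ A₁]
  [NonUnitalRing A₂] [Module ℂ A₂] [IsScalarTower ℂ A₂ A₂] [SMulCommClass ℂ A₂ A₂]
  [NonUnitalRing C] [Module ℂ C] [IsScalarTower ℂ C C] [SMulCommClass ℂ C C]

/-- Values in `C` (with a unit adjoined) together with at most one unevaluated left-most letter. -/
abbrev Pending (A₁ A₂ C : Type u) [NonUnitalRing A₁] [Module ℂ A₁] [NonUnitalRing A₂] [Module ℂ A₂]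
    [NonUnitalRing C] [Module ℂ C] : Type u :=
  Unitization ℂ C × ((A₁ ⊗[ℂ] Unitization ℂ C) × (A₂ ⊗[ℂ] Unitization ℂ C))

/-- `a ⊗ c ↦ f(a) c`. -/
def evalLetter {A : Type u} [NonUnitalRing A] [Module ℂ A] (f : A →ₗ[ℂ] C) :
    A ⊗[ℂ] Unitization ℂ C →ₗ[ℂ] Unitization ℂ C :=
  LinearMap.mul' ℂ (Unitization ℂ C) ∘ₗ
    TensorProduct.map ((Unitization.inrHom ℂ ℂ C) ∘ₗ f) LinearMap.id

/-- Evaluation of the pending letter. -/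
def evalPending (f : A₁ →ₗ[ℂ] C) (g : A₂ →ₗ[ℂ] C) :
    Pending A₁ A₂ C →ₗ[ℂ] Unitization ℂ C :=
  LinearMap.coprod LinearMap.id (LinearMap.coprod (evalLetter f) (evalLetter g))

/-- Left multiplication of `A` on `A ⊗ W`. -/
def letterMul {A : Type u} [NonUnitalRing A] [Module ℂ A] [IsScalarTower ℂ A A]
    [SMulCommClass ℂ A A] (W : Type u) [AddCommGroup W] [Module ℂ W] :
    A →ₙₐ[ℂ] Module.End ℂ (A ⊗[ℂ] W) where
  toFun a := (LinearMap.mulLeft ℂ a).rTensor W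
  map_smul' c a := TensorProduct.ext' fun x w => by
    simp [TensorProduct.smul_tmul', smul_mul_assoc]
  map_zero' := TensorProduct.ext' fun x w => by simp
  map_add' a a' := TensorProduct.ext' fun x w => by simp [TensorProduct.add_tmul, add_mul]
  map_mul' a a' := TensorProduct.ext' fun x w => by simp

/-- Left multiplication by a letter from `A₁`: it is merged with a pending letter from `A₁`, while
a pending letter from `A₂` is evaluated first. -/
def pushLeft (g : A₂ →ₗ[ℂ] C) : A₁ →ₙₐ[ℂ] Module.End ℂ (Pending A₁ A₂ C) where
  toFun a :=
    { toFun := fun n => (0, a ⊗ₜ (n.1 + evalLetter g n.2.2) + letterMul _ a n.2.1, 0)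
      map_add' := fun m n => by
        simp only [Prod.fst_add, Prod.snd_add, map_add, TensorProduct.tmul_add, Prod.mk_add_mk,
          add_zero]
        congr 2
        abel
      map_smul' := fun c n => by
        simp [TensorProduct.tmul_add] }
  map_smul' c a := LinearMap.ext fun n => by
    simp [TensorProduct.smul_tmul']
  map_zero' := LinearMap.ext fun n => by simp
  map_add' a a' := LinearMap.ext fun n => by
    simp only [map_add, TensorProduct.add_tmul, LinearMap.coe_mk, AddHom.coe_mk,
      LinearMap.add_apply, Prod.mk_add_mk, add_zero]
    congr 2
    abel
  map_mul' a a' := LinearMap.ext fun n => by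
    simp only [map_mul, LinearMap.coe_mk, AddHom.coe_mk, Module.End.mul_apply, map_add, map_zero,
      add_zero, TensorProduct.tmul_zero, zero_add]
    congr 3

/-- Left multiplication by a letter from `A₂`: it is merged with a pending letter from `A₂`, while
a pending letter from `A₁` is evaluated first. -/
def pushRight (f : A₁ →ₗ[ℂ] C) : A₂ →ₙₐ[ℂ] Module.End ℂ (Pending A₁ A₂ C) where
  toFun b :=
    { toFun := fun n => (0, 0, b ⊗ₜ (n.1 + evalLetter f n.2.1) + letterMul _ b n.2.2)
      map_add' := fun m n => by
        simp only [Prod.fst_add, Prod.snd_add, map_add, TensorProduct.tmul_add, Prod.mk_add_mk,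
          add_zero]
        congr 2
        abel
      map_smul' := fun c n => by
        simp [TensorProduct.tmul_add] }
  map_smul' c b := LinearMap.ext fun n => by
    simp [TensorProduct.smul_tmul']
  map_zero' := LinearMap.ext fun n => by simp
  map_add' b b' := LinearMap.ext fun n => by
    simp only [map_add, TensorProduct.add_tmul, LinearMap.coe_mk, AddHom.coe_mk,
      LinearMap.add_apply, Prod.mk_add_mk, add_zero]
    congr 2
    abel
  map_mul' b b' := LinearMap.ext fun n => by
    simp only [map_mul, LinearMap.coe_mk, AddHom.coe_mk, Module.End.mul_apply, map_add, map_zero,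
      add_zero, TensorProduct.tmul_zero, zero_add]
    congr 3

theorem pushLeft_apply (g : A₂ →ₗ[ℂ] C) (a : A₁) (n : Pending A₁ A₂ C) :
    pushLeft g a n = (0, a ⊗ₜ (n.1 + evalLetter g n.2.2) + letterMul _ a n.2.1, 0) := rfl

theorem pushRight_apply (f : A₁ →ₗ[ℂ] C) (b : A₂) (n : Pending A₁ A₂ C) :
    pushRight f b n = (0, 0, b ⊗ₜ (n.1 + evalLetter f n.2.1) + letterMul _ b n.2.2) := rfl

theorem evalLetter_tmul {A : Type u} [NonUnitalRing A] [Module ℂ A] (f : A →ₗ[ℂ] C) (a : A)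
    (c : Unitization ℂ C) : evalLetter f (a ⊗ₜ c) = Unitization.inr (f a) * c := by
  simp [evalLetter]

/-- For linear maps `f : A₁ → C` and `g : A₂ → C` into an algebra `C`, the linear map
`A₁ ⊔ A₂ → C` sending each alternating word `x₁ ⊗ ⋯ ⊗ xₙ` to the product in `C` of the images of its
letters under `f`, respectively `g` (see `wordMap_word`). It is the linear map given by the
decomposition of `A₁ ⊔ A₂` as the direct sum of the alternating tensor products of `A₁` and `A₂`. -/
def wordMap (f : A₁ →ₗ[ℂ] C) (g : A₂ →ₗ[ℂ] C) : FreeProd A₁ A₂ →ₗ[ℂ] C where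
  toFun x := (evalPending f g
    (FreeProd.lift (pushLeft (C := C) g) (pushRight (C := C) f) x (1, 0))).snd
  map_add' x y := by simp
  map_smul' c x := by simp

/-- The product `h(x) h(x₂) ⋯ h(xₙ)` for a non-empty word with first letter `x`. -/
def wordProd {X D : Type u} [Mul D] (h : X → D) : X → List X → D
  | x, [] => h x
  | x, y :: l => h x * wordProd h y l

theorem evalPending_push (f : A₁ →ₗ[ℂ] C) (g : A₂ →ₗ[ℂ] C) (x : A₁ ⊕ A₂) (l : List (A₁ ⊕ A₂))
    (hl : (x :: l).IsChain (fun y z => y.isLeft ≠ z.isLeft)) :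
    ∃ c : Unitization ℂ C,
      (FreeProd.lift (pushLeft (C := C) g) (pushRight (C := C) f)
        (wordProd (Sum.elim (FreeProd.inl A₁ A₂) (FreeProd.inr A₁ A₂)) x l) (1, 0)
          = Sum.elim (fun a => (0, a ⊗ₜ c, 0)) (fun b => (0, 0, b ⊗ₜ c)) x) ∧
      (Unitization.inr (Sum.elim f g x) * c = Unitization.inr (wordProd (Sum.elim f g) x l)) := by
  induction l generalizing x with
  | nil =>
    refine ⟨1, ?_, by simp [wordProd]⟩
    cases x <;> simp [wordProd, pushLeft_apply, pushRight_apply]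
  | cons y l ih =>
    obtain ⟨hxy, hl'⟩ := List.isChain_cons_cons.1 hl
    obtain ⟨c, h₁, h₂⟩ := ih y hl'
    refine ⟨Unitization.inr (wordProd (Sum.elim f g) y l), ?_, by simp [wordProd]⟩
    rw [wordProd, map_mul, Module.End.mul_apply, h₁, ← h₂]
    cases x <;> cases y <;>
      simp [pushLeft_apply, pushRight_apply, evalLetter_tmul] at hxy ⊢

/-- On alternating words, `wordMap` is the product of the images of the letters. -/
theorem wordMap_word (f : A₁ →ₗ[ℂ] C) (g : A₂ →ₗ[ℂ] C) (x : A₁ ⊕ A₂) (l : List (A₁ ⊕ A₂))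
    (hl : (x :: l).IsChain (fun y z => y.isLeft ≠ z.isLeft)) :
    wordMap f g (wordProd (Sum.elim (FreeProd.inl A₁ A₂) (FreeProd.inr A₁ A₂)) x l)
      = wordProd (Sum.elim f g) x l := by
  obtain ⟨c, h₁, h₂⟩ := evalPending_push f g x l hl
  change (evalPending f g _).snd = _
  rw [h₁, ← Unitization.snd_inr ℂ (wordProd (Sum.elim f g) x l), ← h₂]
  cases x <;> simp [evalPending, evalLetter_tmul]

end WordMap

/-! ### Independences -/

/-- A product of linear functionals on algebras with values in the linear functionals on the free
products, such that the axioms of a (not necessarily positive) `⊙`-independence hold. -/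
structure Independence : Type (u + 1) where
  /-- The functional `φ₁ ⊙ φ₂` on `A₁ ⊔ A₂`. -/
  prod : ∀ {A₁ A₂ : Type u}
    [NonUnitalRing A₁] [Module ℂ A₁] [IsScalarTower ℂ A₁ A₁] [SMulCommClass ℂ A₁ A₁]
    [NonUnitalRing A₂] [Module ℂ A₂] [IsScalarTower ℂ A₂ A₂] [SMulCommClass ℂ A₂ A₂],
    (A₁ →ₗ[ℂ] ℂ) → (A₂ →ₗ[ℂ] ℂ) → (FreeProd A₁ A₂ →ₗ[ℂ] ℂ)
  /-- `(φ₁ ⊙ φ₂) ∘ i₁ = φ₁` -/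
  prod_inl : ∀ {A₁ A₂ : Type u}
    [NonUnitalRing A₁] [Module ℂ A₁] [IsScalarTower ℂ A₁ A₁] [SMulCommClass ℂ A₁ A₁]
    [NonUnitalRing A₂] [Module ℂ A₂] [IsScalarTower ℂ A₂ A₂] [SMulCommClass ℂ A₂ A₂]
    (φ₁ : A₁ →ₗ[ℂ] ℂ) (φ₂ : A₂ →ₗ[ℂ] ℂ) (a : A₁), prod φ₁ φ₂ (FreeProd.inl A₁ A₂ a) = φ₁ a
  /-- `(φ₁ ⊙ φ₂) ∘ i₂ = φ₂` -/
  prod_inr : ∀ {A₁ A₂ : Type u}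
    [NonUnitalRing A₁] [Module ℂ A₁] [IsScalarTower ℂ A₁ A₁] [SMulCommClass ℂ A₁ A₁]
    [NonUnitalRing A₂] [Module ℂ A₂] [IsScalarTower ℂ A₂ A₂] [SMulCommClass ℂ A₂ A₂]
    (φ₁ : A₁ →ₗ[ℂ] ℂ) (φ₂ : A₂ →ₗ[ℂ] ℂ) (b : A₂), prod φ₁ φ₂ (FreeProd.inr A₁ A₂ b) = φ₂ b
  /-- `(φ₁ ⊙ φ₂) ⊙ φ₃ = φ₁ ⊙ (φ₂ ⊙ φ₃)` -/
  prod_assoc : ∀ {A₁ A₂ A₃ : Type u}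
    [NonUnitalRing A₁] [Module ℂ A₁] [IsScalarTower ℂ A₁ A₁] [SMulCommClass ℂ A₁ A₁]
    [NonUnitalRing A₂] [Module ℂ A₂] [IsScalarTower ℂ A₂ A₂] [SMulCommClass ℂ A₂ A₂]
    [NonUnitalRing A₃] [Module ℂ A₃] [IsScalarTower ℂ A₃ A₃] [SMulCommClass ℂ A₃ A₃]
    (φ₁ : A₁ →ₗ[ℂ] ℂ) (φ₂ : A₂ →ₗ[ℂ] ℂ) (φ₃ : A₃ →ₗ[ℂ] ℂ) (x : FreeProd (FreeProd A₁ A₂) A₃),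
    prod (prod φ₁ φ₂) φ₃ x = prod φ₁ (prod φ₂ φ₃) (FreeProd.assoc A₁ A₂ A₃ x)
  /-- `(φ₁ ∘ j₁) ⊙ (φ₂ ∘ j₂) = (φ₁ ⊙ φ₂) ∘ (j₁ ∐ j₂)` -/
  prod_comp : ∀ {A₁ A₂ C₁ C₂ : Type u}
    [NonUnitalRing A₁] [Module ℂ A₁] [IsScalarTower ℂ A₁ A₁] [SMulCommClass ℂ A₁ A₁]
    [NonUnitalRing A₂] [Module ℂ A₂] [IsScalarTower ℂ A₂ A₂] [SMulCommClass ℂ A₂ A₂]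
    [NonUnitalRing C₁] [Module ℂ C₁] [IsScalarTower ℂ C₁ C₁] [SMulCommClass ℂ C₁ C₁]
    [NonUnitalRing C₂] [Module ℂ C₂] [IsScalarTower ℂ C₂ C₂] [SMulCommClass ℂ C₂ C₂]
    (φ₁ : C₁ →ₗ[ℂ] ℂ) (φ₂ : C₂ →ₗ[ℂ] ℂ) (j₁ : A₁ →ₙₐ[ℂ] C₁) (j₂ : A₂ →ₙₐ[ℂ] C₂),
    prod (φ₁ ∘ₗ (j₁ : A₁ →ₗ[ℂ] C₁)) (φ₂ ∘ₗ (j₂ : A₂ →ₗ[ℂ] C₂))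
      = prod φ₁ φ₂ ∘ₗ (FreeProd.map j₁ j₂ : FreeProd A₁ A₂ →ₗ[ℂ] FreeProd C₁ C₂)

/-! ### Dual semigroups -/

section DualSemigroups

variable {B : Type u} [NonUnitalRing B] [Module ℂ B] [IsScalarTower ℂ B B] [SMulCommClass ℂ B B]

/-- A `*`-algebra `B` with the homomorphism `Δ : B → B ⊔ B` is a dual semigroup. -/
structure IsDualSemigroup [StarRing B] [StarModule ℂ B] (Δ : B →ₙₐ[ℂ] FreeProd B B) : Prop where
  map_star : ∀ b, Δ (star b) = star (Δ b)
  /-- `(Δ ∐ id) ∘ Δ = (id ∐ Δ) ∘ Δ` -/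
  coassoc : ∀ b, FreeProd.assoc B B B (FreeProd.map Δ (NonUnitalAlgHom.id ℂ B) (Δ b))
    = FreeProd.map (NonUnitalAlgHom.id ℂ B) Δ (Δ b)
  /-- `(0 ⊔ id) ∘ Δ = id` -/
  counit_left : ∀ b, FreeProd.lift (0 : B →ₙₐ[ℂ] B) (NonUnitalAlgHom.id ℂ B) (Δ b) = b
  /-- `(id ⊔ 0) ∘ Δ = id` -/
  counit_right : ∀ b, FreeProd.lift (NonUnitalAlgHom.id ℂ B) (0 : B →ₙₐ[ℂ] B) (Δ b) = b

/-- The comultiplication `T(Δ) : T(B) → T(B) ⊔ T(B)` extending `(i_B ⊔ i_B) ∘ Δ`, where `i_B ⊔ i_B`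
replaces each letter `b` of an alternating word by `i_B(b)`, in the same copy of `T(B)`. -/
def tensorComul (Δ : B →ₙₐ[ℂ] FreeProd B B) : TAlg B →ₙₐ[ℂ] FreeProd (TAlg B) (TAlg B) :=
  TAlg.lift (wordMap
    ((FreeProd.inl (TAlg B) (TAlg B) : TAlg B →ₗ[ℂ] FreeProd (TAlg B) (TAlg B)) ∘ₗ TAlg.ι)
    ((FreeProd.inr (TAlg B) (TAlg B) : TAlg B →ₗ[ℂ] FreeProd (TAlg B) (TAlg B)) ∘ₗ TAlg.ι)
      ∘ₗ (Δ : B →ₗ[ℂ] FreeProd B B))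

variable (B) in
/-- The multiplication map `M = T(id) : T(B) → B`. -/
def mulMap : TAlg B →ₙₐ[ℂ] B := TAlg.lift LinearMap.id

/-- The convolution `φ₁ ⋆ φ₂ = (φ₁ ⊙ φ₂) ∘ Δ`. -/
def conv (P : Independence.{u}) (Δ : B →ₙₐ[ℂ] FreeProd B B) (φ₁ φ₂ : B →ₗ[ℂ] ℂ) : B →ₗ[ℂ] ℂ :=
  P.prod φ₁ φ₂ ∘ₗ (Δ : B →ₗ[ℂ] FreeProd B B)

end DualSemigroups

/-! ### Convolution exponentials on coalgebras -/

section CoalgebraExp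

variable {C : Type u} [AddCommGroup C] [Module ℂ C]

/-- The convolution powers `F^{⋆ n}` of a linear functional with respect to a comultiplication
`Δ` and a counit `δ`. -/
def coalgPow (Δ : C →ₗ[ℂ] C ⊗[ℂ] C) (δ F : C →ₗ[ℂ] ℂ) : ℕ → (C →ₗ[ℂ] ℂ)
  | 0 => δ
  | n + 1 => LinearMap.mul' ℂ ℂ ∘ₗ TensorProduct.map (coalgPow Δ δ F n) F ∘ₗ Δ

/-- `E = exp_⋆ F`, that is, the series `∑ F^{⋆ n} / n!` converges pointwise to `E`. -/
def IsCoalgExp (Δ : C →ₗ[ℂ] C ⊗[ℂ] C) (δ F E : C →ₗ[ℂ] ℂ) : Prop :=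
  ∀ c, HasSum (fun n : ℕ => (n.factorial : ℂ)⁻¹ * coalgPow Δ δ F n c) (E c)

end CoalgebraExp

/-! ### Convolution exponentials on dual semigroups -/

section Exp

variable {V : Type u} [AddCommGroup V] [Module ℂ V]

/-- The character `S(φ) : S(V) → ℂ` extending a linear functional `φ` on `V`. -/
def symChar (φ : V →ₗ[ℂ] ℂ) : SymmetricAlgebra ℂ V →ₐ[ℂ] ℂ := SymmetricAlgebra.lift φ

theorem differentiable_symChar (ψ : V →ₗ[ℂ] ℂ) (c : SymmetricAlgebra ℂ V) :
    Differentiable ℝ (fun t : ℝ => symChar (t • ψ) c) := by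
  induction c using SymmetricAlgebra.induction with
  | algebraMap r => simp
  | ι v =>
    simp only [symChar, SymmetricAlgebra.lift_ι_apply, LinearMap.smul_apply]
    fun_prop
  | mul a b ha hb =>
    simp only [map_mul]
    exact ha.mul hb
  | add a b ha hb =>
    simp only [map_add]
    exact ha.add hb

/-- The linear functional `D(ψ)(c) = d/dt S(t ψ)(c) |_{t = 0}` on `S(V)`. -/
def symDeriv (ψ : V →ₗ[ℂ] ℂ) : SymmetricAlgebra ℂ V →ₗ[ℂ] ℂ where
  toFun c := deriv (fun t : ℝ => symChar (t • ψ) c) 0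
  map_add' x y := by
    simp only [map_add]
    exact deriv_add (differentiable_symChar ψ x 0) (differentiable_symChar ψ y 0)
  map_smul' r x := by
    simp only [map_smul]
    exact deriv_const_smul r (differentiable_symChar ψ x 0)

/-- `σ : A₁ ⊔ A₂ → S(A₁) ⊗ S(A₂)` represents the independence, in the sense that
`φ₁ ⊙ φ₂ = (S(φ₁) ⊗ S(φ₂)) ∘ σ` for all linear functionals `φ₁` and `φ₂`. -/
def IsSigma (P : Independence.{u}) {A₁ A₂ : Type u}
    [NonUnitalRing A₁] [Module ℂ A₁] [IsScalarTower ℂ A₁ A₁] [SMulCommClass ℂ A₁ A₁]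
    [NonUnitalRing A₂] [Module ℂ A₂] [IsScalarTower ℂ A₂ A₂] [SMulCommClass ℂ A₂ A₂]
    (σ : FreeProd A₁ A₂ →ₗ[ℂ] SymmetricAlgebra ℂ A₁ ⊗[ℂ] SymmetricAlgebra ℂ A₂) : Prop :=
  ∀ (φ₁ : A₁ →ₗ[ℂ] ℂ) (φ₂ : A₂ →ₗ[ℂ] ℂ), P.prod φ₁ φ₂ =
    LinearMap.mul' ℂ ℂ ∘ₗ
      TensorProduct.map (symChar φ₁).toLinearMap (symChar φ₂).toLinearMap ∘ₗ σ

variable {B : Type u} [NonUnitalRing B] [Module ℂ B] [IsScalarTower ℂ B B] [SMulCommClass ℂ B B]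

/-- The comultiplication `S(σ ∘ Δ)` of `S(B)`. -/
def symComul (σ : FreeProd B B →ₗ[ℂ] SymmetricAlgebra ℂ B ⊗[ℂ] SymmetricAlgebra ℂ B)
    (Δ : B →ₙₐ[ℂ] FreeProd B B) :
    SymmetricAlgebra ℂ B →ₐ[ℂ] SymmetricAlgebra ℂ B ⊗[ℂ] SymmetricAlgebra ℂ B :=
  SymmetricAlgebra.lift (σ ∘ₗ (Δ : B →ₗ[ℂ] FreeProd B B))

/-- `χ = exp_⋆ ψ` for a linear functional `ψ` on `(B, Δ)`: `χ` is the restriction to `B` of the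
convolution exponential of `D(ψ)` on `S(B)` with comultiplication `S(σ ∘ Δ)` and counit `S(0)`. -/
def IsConvExp (P : Independence.{u}) (Δ : B →ₙₐ[ℂ] FreeProd B B) (ψ χ : B →ₗ[ℂ] ℂ) : Prop :=
  ∃ (σ : FreeProd B B →ₗ[ℂ] SymmetricAlgebra ℂ B ⊗[ℂ] SymmetricAlgebra ℂ B)
    (E : SymmetricAlgebra ℂ B →ₗ[ℂ] ℂ),
    IsSigma P σ ∧
    IsCoalgExp (symComul σ Δ).toLinearMap (symChar (0 : B →ₗ[ℂ] ℂ)).toLinearMap (symDeriv ψ) E ∧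
    χ = E ∘ₗ SymmetricAlgebra.ι ℂ B

open Classical in
/-- The convolution exponential `exp_⋆ ψ`, with the value `0` if there is none. -/
def convExp (P : Independence.{u}) (Δ : B →ₙₐ[ℂ] FreeProd B B) (ψ : B →ₗ[ℂ] ℂ) : B →ₗ[ℂ] ℂ :=
  if h : ∃ χ, IsConvExp P Δ ψ χ then h.choose else 0

end Exp

end DualSemi

end

noncomputable section

open scoped TensorProduct

namespace DualSemi

set_option linter.unusedSectionVars false

/-! ### Words in the free product with a unit adjoined -/

section Words

variable {A₁ A₂ C₁ C₂ : Type u}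
  [NonUnitalRing A₁] [Module ℂ A₁] [IsScalarTower ℂ A₁ A₁] [SMulCommClass ℂ A₁ A₁]
  [NonUnitalRing A₂] [Module ℂ A₂] [IsScalarTower ℂ A₂ A₂] [SMulCommClass ℂ A₂ A₂]
  [NonUnitalRing C₁] [Module ℂ C₁] [IsScalarTower ℂ C₁ C₁] [SMulCommClass ℂ C₁ C₁]
  [NonUnitalRing C₂] [Module ℂ C₂] [IsScalarTower ℂ C₂ C₂] [SMulCommClass ℂ C₂ C₂]

/-! The core is the relation (M ∐ M) ∘ T(Δ) = Δ ∘ M (`map_mulMap_tensorComul`): T(Δ) only relabels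
the letters of Δ(b), and multiplying back turns the relabelled word into the original one.
Naturality of ⊙ then gives (a). For (b), naturality of σ makes S(M) intertwine the comultiplications
of S(T(B)) and S(B). Since D(ψ ∘ M) = D(ψ) ∘ S(M) and the counits correspond, every convolution
power, and hence the exponential, pulls back along M (`IsConvExp.comp`). In particular nothing about
coassociativity of T(Δ) is needed. Part (c) is immediate from (b), because M is a *-homomorphism.

The work lies in showing that the exponential on B exists, which requires two facts.

Existence of σ (`exists_isSigma`): (φ₁ ⊙ φ₂)(word) must be a polynomial in values of φ₁ and φ₂, and
only naturality is available. Matrix amplifications supply it. First, a linear combination ∑ tₖ φₖ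
of fixed functionals is one fixed functional composed with a homomorphism into matrices that is
affine in t, so multilinearity gives polynomiality in t (`wordForm_combination_mem`). Second, after
pulling back to a free algebra on N generators, a word value is split into finitely many terms whose
functionals vanish on words longer than N, hence are such combinations (`wordForm_mem`).

Convergence (`exists_isCoalgExp`): F^{⋆n} = δ ∘ Lⁿ with L = (id ⊗ F) ∘ Δ, and in a coalgebra each
element lies in a finite-dimensional L-invariant subspace, where the series is a matrix exponential.
Coassociativity and counit of S(B) are tested against characters, which separate points. -/

variable (A₁ A₂) in
/-- The inclusion of `A₁ ⊔ A₂` into the free product with a unit adjoined. -/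
def FreeProd.val : FreeProd A₁ A₂ →ₙₐ[ℂ] UFreeProd A₁ A₂ where
  toFun x := x.1
  map_smul' _ _ := rfl
  map_zero' := rfl
  map_add' _ _ := rfl
  map_mul' _ _ := rfl

theorem FreeProd.val_injective : Function.Injective (FreeProd.val A₁ A₂) := Subtype.val_injective

theorem UFreeProd.counit_val (x : FreeProd A₁ A₂) :
    UFreeProd.counit A₁ A₂ (FreeProd.val A₁ A₂ x) = 0 := x.2

/-- Linear maps on the free product with a unit are determined by their values on words. -/
theorem UFreeProd.span_words : Submodule.span ℂ
    {x : UFreeProd A₁ A₂ | ∃ l : List (A₁ × A₂), x = (l.map FreeProd.letter).prod} = ⊤ := by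
  have h : Algebra.adjoin ℂ (Set.range (FreeProd.letter (A₁ := A₁) (A₂ := A₂))) = ⊤ := by
    have h₁ := TensorAlgebra.adjoin_range_ι (R := ℂ) (M := A₁ × A₂)
    have h₂ := congrArg (Subalgebra.map (RingQuot.mkAlgHom ℂ (FreeProd.Rel A₁ A₂))) h₁
    rw [AlgHom.map_adjoin, ← Set.range_comp, Algebra.map_top,
      (AlgHom.range_eq_top _).2 (RingQuot.mkAlgHom_surjective ℂ _)] at h₂
    exact h₂
  rw [eq_top_iff, ← Algebra.top_toSubmodule, ← h, Algebra.adjoin_eq_span]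
  refine Submodule.span_mono fun x hx => ?_
  obtain ⟨l, hl, rfl⟩ := Submonoid.exists_list_of_mem_closure hx
  obtain ⟨m, rfl⟩ : ∃ m : List (A₁ × A₂), m.map FreeProd.letter = l := by
    rw [← Set.mem_range, Set.range_list_map]
    exact hl
  exact ⟨m, rfl⟩

/-- The projection of the free product with a unit onto `A₁ ⊔ A₂`. -/
def FreeProd.proj : UFreeProd A₁ A₂ →ₗ[ℂ] FreeProd A₁ A₂ where
  toFun x := ⟨x - algebraMap ℂ _ (UFreeProd.counit A₁ A₂ x), by
    change UFreeProd.counit A₁ A₂ _ = 0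
    rw [map_sub, AlgHom.commutes]
    exact sub_self _⟩
  map_add' x y := Subtype.ext (by
    change x + y - algebraMap ℂ _ (UFreeProd.counit A₁ A₂ (x + y)) = (x - _) + (y - _)
    rw [map_add, map_add]
    abel)
  map_smul' c x := Subtype.ext (by
    change c • x - algebraMap ℂ _ (UFreeProd.counit A₁ A₂ (c • x)) = c • (x - _)
    rw [map_smul, smul_sub, smul_eq_mul, map_mul, ← Algebra.smul_def])

theorem FreeProd.val_proj (x : UFreeProd A₁ A₂) : FreeProd.val A₁ A₂ (FreeProd.proj x)
    = x - algebraMap ℂ _ (UFreeProd.counit A₁ A₂ x) := rfl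

theorem FreeProd.proj_val (x : FreeProd A₁ A₂) : FreeProd.proj (FreeProd.val A₁ A₂ x) = x := by
  apply FreeProd.val_injective
  rw [FreeProd.val_proj, UFreeProd.counit_val, map_zero, sub_zero]

theorem UFreeProd.algHom_ext {U : Type w} [Ring U] [Algebra ℂ U] {f g : UFreeProd A₁ A₂ →ₐ[ℂ] U}
    (h : ∀ p, f (FreeProd.letter p) = g (FreeProd.letter p)) : f = g := by
  apply RingQuot.ringQuot_ext'
  apply TensorAlgebra.hom_ext
  exact LinearMap.ext h

/-- The unital homomorphism `j₁ ∐ j₂`. -/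
def UFreeProd.map (j₁ : A₁ →ₙₐ[ℂ] C₁) (j₂ : A₂ →ₙₐ[ℂ] C₂) :
    UFreeProd A₁ A₂ →ₐ[ℂ] UFreeProd C₁ C₂ :=
  UFreeProd.lift ((FreeProd.val C₁ C₂).comp ((FreeProd.inl C₁ C₂).comp j₁))
    ((FreeProd.val C₁ C₂).comp ((FreeProd.inr C₁ C₂).comp j₂))

theorem UFreeProd.map_letter (j₁ : A₁ →ₙₐ[ℂ] C₁) (j₂ : A₂ →ₙₐ[ℂ] C₂) (p : A₁ × A₂) :
    UFreeProd.map j₁ j₂ (FreeProd.letter p) = FreeProd.letter (j₁ p.1, j₂ p.2) := by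
  rw [UFreeProd.map, UFreeProd.lift_letter]
  change FreeProd.letter (j₁ p.1, 0) + FreeProd.letter (0, j₂ p.2) = _
  rw [← map_add, Prod.mk_add_mk, add_zero, zero_add]

theorem UFreeProd.counit_map (j₁ : A₁ →ₙₐ[ℂ] C₁) (j₂ : A₂ →ₙₐ[ℂ] C₂) (x : UFreeProd A₁ A₂) :
    UFreeProd.counit C₁ C₂ (UFreeProd.map j₁ j₂ x) = UFreeProd.counit A₁ A₂ x := by
  have h : (UFreeProd.counit C₁ C₂).comp (UFreeProd.map j₁ j₂) = UFreeProd.counit A₁ A₂ :=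
    UFreeProd.algHom_ext fun p => by
      rw [AlgHom.comp_apply, UFreeProd.map_letter, FreeProd.counit_letter, FreeProd.counit_letter]
  exact DFunLike.congr_fun h x

theorem FreeProd.val_map (j₁ : A₁ →ₙₐ[ℂ] C₁) (j₂ : A₂ →ₙₐ[ℂ] C₂) (x : FreeProd A₁ A₂) :
    FreeProd.val C₁ C₂ (FreeProd.map j₁ j₂ x) = UFreeProd.map j₁ j₂ (FreeProd.val A₁ A₂ x) := by
  have h : (FreeProd.val C₁ C₂).comp (FreeProd.map j₁ j₂)
      = ((UFreeProd.map j₁ j₂ : UFreeProd A₁ A₂ →ₐ[ℂ] UFreeProd C₁ C₂) :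
        UFreeProd A₁ A₂ →ₙₐ[ℂ] UFreeProd C₁ C₂).comp (FreeProd.val A₁ A₂) := by
    refine FreeProd.hom_ext (fun a => ?_) (fun b => ?_)
    · rw [NonUnitalAlgHom.comp_apply, NonUnitalAlgHom.comp_apply, FreeProd.map, FreeProd.lift_inl]
      exact ((UFreeProd.map_letter j₁ j₂ (a, 0)).trans (by rw [map_zero]; rfl)).symm
    · rw [NonUnitalAlgHom.comp_apply, NonUnitalAlgHom.comp_apply, FreeProd.map, FreeProd.lift_inr]
      exact ((UFreeProd.map_letter j₁ j₂ (0, b)).trans (by rw [map_zero]; rfl)).symm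
  exact DFunLike.congr_fun h x

theorem FreeProd.proj_map (j₁ : A₁ →ₙₐ[ℂ] C₁) (j₂ : A₂ →ₙₐ[ℂ] C₂) (x : UFreeProd A₁ A₂) :
    FreeProd.proj (UFreeProd.map j₁ j₂ x) = FreeProd.map j₁ j₂ (FreeProd.proj x) := by
  apply FreeProd.val_injective
  rw [FreeProd.val_map, FreeProd.val_proj, FreeProd.val_proj, map_sub, AlgHom.commutes,
    UFreeProd.counit_map]

namespace Independence

variable (P : Independence.{u})

/-- The values of `φ₁ ⊙ φ₂` on words with `N` letters, as a multilinear map of the letters. -/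
def wordForm (φ₁ : A₁ →ₗ[ℂ] ℂ) (φ₂ : A₂ →ₗ[ℂ] ℂ) (N : ℕ) :
    MultilinearMap ℂ (fun _ : Fin N => A₁ × A₂) ℂ :=
  (P.prod φ₁ φ₂ ∘ₗ FreeProd.proj).compMultilinearMap
    ((MultilinearMap.mkPiAlgebraFin ℂ N (UFreeProd A₁ A₂)).compLinearMap
      fun _ => FreeProd.letter)

theorem wordForm_apply (φ₁ : A₁ →ₗ[ℂ] ℂ) (φ₂ : A₂ →ₗ[ℂ] ℂ) (N : ℕ) (p : Fin N → A₁ × A₂) :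
    P.wordForm φ₁ φ₂ N p
      = P.prod φ₁ φ₂ (FreeProd.proj (List.ofFn fun i => FreeProd.letter (p i)).prod) := by
  simp [wordForm]

/-- Naturality of ⊙ in multilinear form: a homomorphism can be moved from the functionals to the
letters, where a sum can be expanded. All polynomiality arguments use this trade. -/
theorem wordForm_comp (φ₁ : C₁ →ₗ[ℂ] ℂ) (φ₂ : C₂ →ₗ[ℂ] ℂ) (j₁ : A₁ →ₙₐ[ℂ] C₁)
    (j₂ : A₂ →ₙₐ[ℂ] C₂) (N : ℕ) (p : Fin N → A₁ × A₂) :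
    P.wordForm (φ₁ ∘ₗ (j₁ : A₁ →ₗ[ℂ] C₁)) (φ₂ ∘ₗ (j₂ : A₂ →ₗ[ℂ] C₂)) N p
      = P.wordForm φ₁ φ₂ N fun i => (j₁ (p i).1, j₂ (p i).2) := by
  rw [wordForm_apply, wordForm_apply, P.prod_comp]
  change P.prod φ₁ φ₂ (FreeProd.map j₁ j₂ _) = _
  rw [← FreeProd.proj_map, map_list_prod, List.map_ofFn]
  congr 4
  funext i
  exact UFreeProd.map_letter j₁ j₂ (p i)

end Independence

end Words

/-! ### Polynomial dependence on linear combinations of functionals -/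

section Combination

variable {A : Type u} [NonUnitalRing A] [Module ℂ A] [IsScalarTower ℂ A A] [SMulCommClass ℂ A A]
variable {K : Type u} [Fintype K] [DecidableEq K]

/-- The homomorphism from `A` to matrices over `A` whose value at `a` has the single non-zero column
`(a, (t k • a)ₖ)`. -/
def colHom (t : K → ℂ) : A →ₙₐ[ℂ] Matrix (Option K) (Option K) A where
  toFun a := Matrix.of fun i j => if j = none then i.elim 1 t • a else 0
  map_smul' c a := by
    ext i j
    by_cases h : j = none <;> simp [h, smul_comm c]
  map_zero' := by
    ext i j
    simp
  map_add' a b := by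
    ext i j
    by_cases h : j = none <;> simp [h]
  -- Only the column `none` is non-zero and its entry in row `none` has coefficient 1, so a product
  -- keeps the coefficient of its left factor and nothing else.
  map_mul' a b := by
    ext i j
    by_cases h : j = none <;> simp [h, Matrix.mul_apply, smul_mul_assoc]

theorem colHom_apply (t : K → ℂ) (a : A) :
    colHom t a = ∑ o : Option K, o.elim 1 t • Matrix.single o none a := by
  ext i j
  simp only [Matrix.sum_apply, Matrix.smul_apply, Matrix.single_apply, smul_ite, smul_zero]
  rcases j with _ | j <;> simp [colHom]

/-- The functional `M ↦ ∑ₖ φₖ(M k none)`. -/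
def colFun (φ : K → A →ₗ[ℂ] ℂ) : Matrix (Option K) (Option K) A →ₗ[ℂ] ℂ :=
  ∑ k, φ k ∘ₗ Matrix.entryLinearMap ℂ A (some k) none

/-- Separates the parameters from the functionals: t enters only through the homomorphism, while
`colFun φ` stays fixed. -/
theorem colFun_comp_colHom (φ : K → A →ₗ[ℂ] ℂ) (t : K → ℂ) :
    colFun φ ∘ₗ (colHom (A := A) t : A →ₗ[ℂ] Matrix (Option K) (Option K) A) = ∑ k, t k • φ k := by
  ext a
  simp [colFun, colHom, LinearMap.sum_apply]

variable {A' : Type u} [NonUnitalRing A'] [Module ℂ A'] [IsScalarTower ℂ A' A']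
  [SMulCommClass ℂ A' A']

/-- Both combinations factor through `colHom`, whose value on a letter is linear in the coefficients
(1, t), respectively (1, s). Expanding the multilinear word form gives constants times products of N
such coefficients, and these lie in the subalgebra `R`. -/
theorem Independence.wordForm_combination_mem (P : Independence.{u}) {T : Type w}
    (R : Subalgebra ℂ (T → ℂ)) (φ : K → A →ₗ[ℂ] ℂ) (φ' : K → A' →ₗ[ℂ] ℂ) (t s : K → T → ℂ)
    (ht : ∀ k, t k ∈ R) (hs : ∀ k, s k ∈ R) (N : ℕ) (p : Fin N → A × A') :
    (fun τ => P.wordForm (∑ k, t k τ • φ k) (∑ k, s k τ • φ' k) N p) ∈ R := by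
  -- One summand `Option K` for each of the two algebras; the index `none` carries the constant
  -- coefficient 1.
  let c : Option K ⊕ Option K → T → ℂ :=
    Sum.elim (fun o => o.elim 1 t) (fun o => o.elim 1 s)
  let q : Option K ⊕ Option K → A × A' →
      Matrix (Option K) (Option K) A × Matrix (Option K) (Option K) A' := fun o x =>
    o.elim (fun o => (Matrix.single o none x.1, 0)) (fun o => (0, Matrix.single o none x.2))
  have hc : ∀ o, c o ∈ R := by
    rintro ((_ | k) | (_ | k))
    exacts [one_mem R, ht k, one_mem R, hs k]
  have key : (fun τ => P.wordForm (∑ k, t k τ • φ k) (∑ k, s k τ • φ' k) N p)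
      = ∑ r : Fin N → Option K ⊕ Option K,
        P.wordForm (colFun φ) (colFun φ') N (fun i => q (r i) (p i)) • ∏ i, c (r i) := by
    funext τ
    rw [← colFun_comp_colHom, ← colFun_comp_colHom, wordForm_comp]
    have h : ∀ x : A × A', (colHom (fun k => t k τ) x.1, colHom (fun k => s k τ) x.2)
        = ∑ o, c o τ • q o x := by
      intro x
      rw [Fintype.sum_sum_type, colHom_apply, colHom_apply]
      ext1
      · simp only [Prod.fst_add, Prod.fst_sum, Prod.smul_fst, q, c, Sum.elim_inl, Sum.elim_inr,
          smul_zero, Finset.sum_const_zero, add_zero]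
        refine Finset.sum_congr rfl fun o _ => ?_
        cases o <;> rfl
      · simp only [Prod.snd_add, Prod.snd_sum, Prod.smul_snd, q, c, Sum.elim_inl, Sum.elim_inr,
          smul_zero, Finset.sum_const_zero, zero_add]
        refine Finset.sum_congr rfl fun o _ => ?_
        cases o <;> rfl
    simp only [h]
    rw [MultilinearMap.map_sum]
    simp only [MultilinearMap.map_smul_univ, Finset.sum_apply, Pi.smul_apply, Finset.prod_apply]
    refine Finset.sum_congr rfl fun r _ => ?_
    rw [smul_eq_mul, smul_eq_mul, mul_comm]
  rw [key]
  exact R.sum_mem fun r _ => R.smul_mem (R.prod_mem fun i _ => hc (r i)) _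

end Combination

/-! ### Polynomial dependence on the functionals -/

section Polynomial

/-- The free (non-unital) algebra over the set `X`. -/
abbrev FreeAlg (X : Type u) : Type u := MonoidAlgebra ℂ (FreeSemigroup X)

variable {A : Type u} [NonUnitalRing A] [Module ℂ A] [IsScalarTower ℂ A A] [SMulCommClass ℂ A A]
variable {X : Type u}

/-- The generators of the free algebra. -/
def FreeAlg.of (x : X) : FreeAlg X := MonoidAlgebra.single (FreeSemigroup.of x) 1

/-- The homomorphism extending a map on the generators. -/
def FreeAlg.lift (a : X → A) : FreeAlg X →ₙₐ[ℂ] A :=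
  MonoidAlgebra.liftMagma ℂ (FreeSemigroup.lift a)

theorem FreeAlg.lift_single (a : X → A) (v : FreeSemigroup X) :
    FreeAlg.lift a (MonoidAlgebra.single v 1) = FreeSemigroup.lift a v := by
  simp [FreeAlg.lift]

theorem FreeAlg.lift_of (a : X → A) (x : X) : FreeAlg.lift a (FreeAlg.of x) = a x := by
  rw [FreeAlg.of, FreeAlg.lift_single, FreeSemigroup.lift_of]

variable {n : Type} [Fintype n]

/-- The homomorphism sending the generator `x` to the elementary tensor of the matrix `Q x` and
`a x`. -/
def FreeAlg.matLift (Q : X → Matrix n n ℂ) (a : X → A) : FreeAlg X →ₙₐ[ℂ] Matrix n n A :=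
  FreeAlg.lift fun x => Matrix.of fun i j => Q x i j • a x

theorem FreeAlg.matLift_of (Q : X → Matrix n n ℂ) (a : X → A) (x : X) :
    FreeAlg.matLift Q a (FreeAlg.of x) = Matrix.of fun i j => Q x i j • a x := FreeAlg.lift_of _ x

/-- The generator `x` goes to `Q x ⊗ a x`, so the scalar matrices and the elements of `A` multiply
independently along a word. -/
theorem FreeAlg.matLift_single (Q : X → Matrix n n ℂ) (a : X → A) (v : FreeSemigroup X) (i j : n) :
    FreeAlg.matLift Q a (MonoidAlgebra.single v 1) i j
      = FreeSemigroup.lift Q v i j • FreeSemigroup.lift a v := by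
  rw [FreeAlg.matLift, FreeAlg.lift_single]
  induction v using FreeSemigroup.recOnMul generalizing i j with
  | ih1 x => simp
  | ih2 x v h₁ h₂ =>
    simp only [map_mul, Matrix.mul_apply, h₁, h₂, smul_mul_smul_comm, Finset.sum_smul]

/-- The functional `M ↦ ∑ᵢ φ(M i j)`. -/
def colSum (j : n) (φ : A →ₗ[ℂ] ℂ) : Matrix n n A →ₗ[ℂ] ℂ :=
  ∑ i, φ ∘ₗ Matrix.entryLinearMap ℂ A i j

theorem colSum_matLift_single (Q : X → Matrix n n ℂ) (a : X → A) (j : n) (φ : A →ₗ[ℂ] ℂ)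
    (v : FreeSemigroup X) : colSum j φ (FreeAlg.matLift Q a (MonoidAlgebra.single v 1))
      = (∑ i, FreeSemigroup.lift Q v i j) * φ (FreeSemigroup.lift a v) := by
  simp [colSum, LinearMap.sum_apply, FreeAlg.matLift_single, Finset.sum_mul]

/-- The row vector of ones is fixed by every `Q x`, hence by every product of them. Amplifying by
such matrices and summing a column therefore leaves a functional unchanged. -/
theorem sum_lift_eq_one (Q : X → Matrix n n ℂ) (hQ : ∀ x j, ∑ i, Q x i j = 1)
    (v : FreeSemigroup X) (j : n) : ∑ i, FreeSemigroup.lift Q v i j = 1 := by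
  induction v using FreeSemigroup.recOnMul generalizing j with
  | ih1 x => simpa using hQ x j
  | ih2 x v h₁ h₂ =>
    simp only [map_mul, Matrix.mul_apply]
    rw [Finset.sum_comm]
    simp only [← Finset.sum_mul, h₁, one_mul, h₂]

theorem colSum_comp_matLift (Q : X → Matrix n n ℂ) (hQ : ∀ x j, ∑ i, Q x i j = 1) (a : X → A)
    (j : n) (φ : A →ₗ[ℂ] ℂ) :
    colSum j φ ∘ₗ (FreeAlg.matLift Q a : FreeAlg X →ₗ[ℂ] Matrix n n A)
      = φ ∘ₗ (FreeAlg.lift a : FreeAlg X →ₗ[ℂ] A) := by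
  refine MonoidAlgebra.lhom_ext' fun v => LinearMap.ext_ring ?_
  change colSum j φ (FreeAlg.matLift Q a (MonoidAlgebra.single v 1))
    = φ (FreeAlg.lift a (MonoidAlgebra.single v 1))
  rw [colSum_matLift_single, sum_lift_eq_one Q hQ, one_mul, FreeAlg.lift_single]

/-- The words of length at most `N`. -/
abbrev ShortWord (X : Type u) (N : ℕ) : Type u := {v : FreeSemigroup X // v.length ≤ N}

instance [Finite X] (N : ℕ) : Finite (ShortWord X N) := by
  have h : Set.Finite {l : List X | l.length ≤ N} := List.finite_length_le X N
  have := h.to_subtype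
  refine Finite.of_injective
    (fun v : ShortWord X N => (⟨v.1.head :: v.1.tail, v.2⟩ : {l : List X | l.length ≤ N})) ?_
  rintro ⟨⟨x, l⟩, _⟩ ⟨⟨y, m⟩, _⟩ h
  simp only at h
  obtain ⟨rfl, rfl⟩ := h
  rfl

/-- The functional on the free algebra taking the coefficient of the word `v`. -/
def coeffFun (v : FreeSemigroup X) : FreeAlg X →ₗ[ℂ] ℂ :=
  Finsupp.lapply v ∘ₗ (MonoidAlgebra.coeffLinearEquiv ℂ).toLinearMap

/-- When column `j` dies on words longer than `N`, only finitely many coefficients survive. The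
functional becomes a finite combination of functionals independent of `φ`, with values of `φ` as
coefficients. -/
theorem colSum_comp_matLift_of_short [Fintype X] {N : ℕ} [Fintype (ShortWord X N)]
    (Q : X → Matrix n n ℂ) (j : n)
    (hQ : ∀ v : FreeSemigroup X, N < v.length → ∀ i, FreeSemigroup.lift Q v i j = 0) (a : X → A)
    (φ : A →ₗ[ℂ] ℂ) :
    colSum j φ ∘ₗ (FreeAlg.matLift Q a : FreeAlg X →ₗ[ℂ] Matrix n n A)
      = ∑ v : ShortWord X N, φ (FreeSemigroup.lift a v.1) •
          ((∑ i, FreeSemigroup.lift Q v.1 i j) • coeffFun v.1) := by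
  refine MonoidAlgebra.lhom_ext' fun v => LinearMap.ext_ring ?_
  change colSum j φ (FreeAlg.matLift Q a (MonoidAlgebra.single v 1))
    = (∑ v : ShortWord X N, φ (FreeSemigroup.lift a v.1) •
          ((∑ i, FreeSemigroup.lift Q v.1 i j) • coeffFun v.1)) (MonoidAlgebra.single v 1)
  classical
  rw [colSum_matLift_single, LinearMap.sum_apply]
  have hc : ∀ u : FreeSemigroup X,
      coeffFun u (MonoidAlgebra.single v (1 : ℂ)) = if v = u then 1 else 0 := fun u => by
    simp [coeffFun, Finsupp.single_apply]
  simp only [LinearMap.smul_apply, hc, smul_eq_mul, mul_ite, mul_one, mul_zero]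
  by_cases hv : v.length ≤ N
  · rw [Finset.sum_eq_single (⟨v, hv⟩ : ShortWord X N)]
    · simp [mul_comm]
    · intro u _ hu
      rw [if_neg]
      rintro rfl
      exact hu rfl
    · simp
  · rw [Finset.sum_eq_zero fun i _ => hQ v (not_le.1 hv) i, zero_mul,
      Finset.sum_eq_zero fun u _ => ?_]
    rw [if_neg]
    rintro rfl
    exact hv u.2

/-- The number `k + 1`, or `N` if this is larger than `N`. -/
def nextFin {N : ℕ} (k : Fin (N + 1)) : Fin (N + 1) :=
  ⟨min (k + 1) N, by omega⟩

/-- Read a word from the right as acting on basis vector 0. A generator lifts level `κ x` to the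
next level and kills all other levels, so a surviving word climbs one level per letter, staying at
the top level `N` once reached, and uses a generator for every level it leaves. -/
theorem lift_single_next {N : ℕ} (κ : X → Fin (N + 1)) (v : FreeSemigroup X) (i : Fin (N + 1))
    (h : FreeSemigroup.lift (fun x => Matrix.single (nextFin (κ x)) (κ x) (1 : ℂ)) v i 0 ≠ 0) :
    i.1 = min v.length N ∧ ∀ k : Fin (N + 1), k.1 < v.length → ∃ x, κ x = k := by
  induction v using FreeSemigroup.recOnMul generalizing i with
  | ih1 x =>
    rw [FreeSemigroup.lift_of, Matrix.single_apply] at h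
    obtain ⟨rfl, hx⟩ : nextFin (κ x) = i ∧ κ x = 0 := by
      by_contra h'
      exact h (if_neg h')
    refine ⟨by simp [nextFin, hx, FreeSemigroup.length_of], fun k hk => ⟨x, ?_⟩⟩
    rw [hx]
    rw [FreeSemigroup.length_of] at hk
    ext
    simp only [Fin.val_zero]
    omega
  | ih2 x v h₁ h₂ =>
    rw [map_mul, FreeSemigroup.lift_of] at h
    by_cases hi : i = nextFin (κ x)
    swap
    · exact absurd (Matrix.single_mul_apply_of_ne _ _ _ _ _ hi _) h
    subst hi
    rw [Matrix.single_mul_apply_same, one_mul] at h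
    obtain ⟨h₃, h₄⟩ := h₂ _ h
    rw [FreeSemigroup.length_mul, FreeSemigroup.length_of]
    refine ⟨?_, fun k hk => ?_⟩
    · simp only [nextFin, h₃]
      omega
    · by_cases hk' : k.1 < v.length
      · exact h₄ k hk'
      -- Here `k` equals the length of `v`; as `k ≤ N`, the cap is not active and the new letter `x`
      -- serves level `k`.
      · refine ⟨x, Fin.ext ?_⟩
        have := k.2
        omega

/-- Pigeonhole: a surviving word of length above `N` would need generators for all `N + 1` levels,
but there are at most `N` generators. -/
theorem lift_single_next_eq_zero {N : ℕ} [Fintype X] (hX : Fintype.card X ≤ N)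
    (κ : X → Fin (N + 1)) (v : FreeSemigroup X) (hv : N < v.length) (i : Fin (N + 1)) :
    FreeSemigroup.lift (fun x => Matrix.single (nextFin (κ x)) (κ x) (1 : ℂ)) v i 0 = 0 := by
  by_contra h
  have h' := (lift_single_next κ v i h).2
  have hs : Function.Surjective κ := fun k => h' k (by have := k.2; omega)
  have := Fintype.card_le_of_surjective κ hs
  rw [Fintype.card_fin] at this
  omega

theorem sum_single_next {N : ℕ} (j : Fin (N + 1)) :
    ∑ i, (∑ k, Matrix.single (nextFin k) k (1 : ℂ)) i j = 1 := by
  simp only [Matrix.sum_apply, Matrix.single_apply, ite_and]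
  rw [Finset.sum_comm]
  simp

variable {A₁ A₂ : Type u}
  [NonUnitalRing A₁] [Module ℂ A₁] [IsScalarTower ℂ A₁ A₁] [SMulCommClass ℂ A₁ A₁]
  [NonUnitalRing A₂] [Module ℂ A₂] [IsScalarTower ℂ A₂ A₂] [SMulCommClass ℂ A₂ A₂]

/-- Values of `φ₁ ⊙ φ₂` on words are polynomials in the values of `φ₁` and `φ₂`. -/
theorem Independence.wordForm_mem (P : Independence.{u})
    (R : Subalgebra ℂ ((A₁ →ₗ[ℂ] ℂ) × (A₂ →ₗ[ℂ] ℂ) → ℂ)) (h₁ : ∀ a, (fun τ => τ.1 a) ∈ R)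
    (h₂ : ∀ b, (fun τ => τ.2 b) ∈ R) (N : ℕ) (p : Fin N → A₁ × A₂) :
    (fun τ => P.wordForm τ.1 τ.2 N p) ∈ R := by
  classical
  -- One generator for each position of the word, even if letters repeat. The lift puts the free
  -- algebra in the universe of the independence.
  let X := ULift.{u} (Fin N)
  let a : X → A₁ := fun x => (p x.down).1
  let b : X → A₂ := fun x => (p x.down).2
  let e : Fin N → FreeAlg X × FreeAlg X := fun i => (FreeAlg.of ⟨i⟩, FreeAlg.of ⟨i⟩)
  -- The full shift has column sums 1, so inserting it does not alter the functionals. Its summands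
  -- `Q κ` assign a single level to each generator.
  let E : X → Matrix (Fin (N + 1)) (Fin (N + 1)) ℂ := fun _ => ∑ k, Matrix.single (nextFin k) k 1
  let Q : (Fin N → Fin (N + 1)) → X → Matrix (Fin (N + 1)) (Fin (N + 1)) ℂ := fun κ x =>
    Matrix.single (nextFin (κ x.down)) (κ x.down) 1
  have : Fintype (ShortWord X N) := Fintype.ofFinite _
  have hQ : ∀ κ (v : FreeSemigroup X), N < v.length → ∀ i, FreeSemigroup.lift (Q κ) v i 0 = 0 :=
    fun κ v hv i => lift_single_next_eq_zero (by simp [X]) (fun x : X => κ x.down) v hv i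
  have key : (fun τ : (A₁ →ₗ[ℂ] ℂ) × (A₂ →ₗ[ℂ] ℂ) => P.wordForm τ.1 τ.2 N p)
      = ∑ κ : Fin N → Fin (N + 1), fun τ => P.wordForm
        (∑ v : ShortWord X N, τ.1 (FreeSemigroup.lift a v.1) •
          ((∑ i, FreeSemigroup.lift (Q κ) v.1 i 0) • coeffFun v.1))
        (∑ v : ShortWord X N, τ.2 (FreeSemigroup.lift b v.1) •
          ((∑ i, FreeSemigroup.lift (Q κ) v.1 i 0) • coeffFun v.1)) N e := by
    funext τ
    have hp : p = fun i => (FreeAlg.lift a (e i).1, FreeAlg.lift b (e i).2) := by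
      funext i
      simp only [e, FreeAlg.lift_of]
      rfl
    conv_lhs => rw [hp]
    rw [← P.wordForm_comp τ.1 τ.2 (FreeAlg.lift a) (FreeAlg.lift b),
      ← colSum_comp_matLift E (fun _ => sum_single_next) a 0,
      ← colSum_comp_matLift E (fun _ => sum_single_next) b 0, P.wordForm_comp]
    have hE : ∀ i, (FreeAlg.matLift E a (e i).1, FreeAlg.matLift E b (e i).2)
        = ∑ k, (Matrix.of fun r c => Matrix.single (nextFin k) k (1 : ℂ) r c • a ⟨i⟩,
          Matrix.of fun r c => Matrix.single (nextFin k) k (1 : ℂ) r c • b ⟨i⟩) := by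
      intro i
      simp only [e, FreeAlg.matLift_of]
      ext r c
      · simp [E, Prod.fst_sum, Matrix.sum_apply, Finset.sum_smul]
      · simp [E, Prod.snd_sum, Matrix.sum_apply, Finset.sum_smul]
    simp only [hE]
    -- Expanding the shift in every letter selects one level `κ i` for each position, the same for
    -- both algebras.
    rw [MultilinearMap.map_sum, Finset.sum_apply]
    refine Finset.sum_congr rfl fun κ _ => ?_
    -- Each summand is again a word form on the free algebra, now with functionals supported on
    -- short words.
    rw [← colSum_comp_matLift_of_short (Q κ) 0 (hQ κ) a,
      ← colSum_comp_matLift_of_short (Q κ) 0 (hQ κ) b, P.wordForm_comp]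
    simp only [e, FreeAlg.matLift_of]
    rfl
  rw [key]
  exact R.sum_mem fun κ _ => P.wordForm_combination_mem R _ _ _ _ (fun v => h₁ _) (fun v => h₂ _) N e

end Polynomial

/-! ### Separation of points by characters -/

section Separation

variable {V : Type u} [AddCommGroup V] [Module ℂ V]

theorem symChar_ι (φ : V →ₗ[ℂ] ℂ) (v : V) : symChar φ (SymmetricAlgebra.ι ℂ V v) = φ v :=
  SymmetricAlgebra.lift_ι_apply _ v

/-- In a basis, S(V) is a polynomial ring and the characters are point evaluations; a polynomial
over an infinite field vanishing at all points is zero. -/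
theorem eq_zero_of_symChar (c : SymmetricAlgebra ℂ V)
    (h : ∀ φ : V →ₗ[ℂ] ℂ, symChar φ c = 0) : c = 0 := by
  let b := Module.Basis.ofVectorSpace ℂ V
  let e := SymmetricAlgebra.equivMvPolynomial b
  have key : ∀ x : Module.Basis.ofVectorSpaceIndex ℂ V → ℂ,
      (MvPolynomial.aeval x).comp (e : SymmetricAlgebra ℂ V →ₐ[ℂ] _)
        = symChar (b.constr ℂ x) := by
    intro x
    apply SymmetricAlgebra.algHom_ext
    refine b.ext fun i => ?_
    simp [e, symChar_ι, SymmetricAlgebra.equivMvPolynomial_ι_apply]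
  apply e.injective
  rw [map_zero]
  refine MvPolynomial.funext fun x => ?_
  rw [map_zero, ← h (b.constr ℂ x), ← key x]
  simp [MvPolynomial.aeval_eq_eval]

variable {V₁ V₂ : Type*} [AddCommGroup V₁] [Module ℂ V₁] [AddCommGroup V₂] [Module ℂ V₂]

/-- Slicing by `f i` gives an element of `V₂` killed by all `g j`, hence 0. Expanding `z` in a basis
of `V₂`, its coefficients in `V₁` are then killed by all `f i`. -/
theorem tensor_eq_zero_of_separating {I J : Type*} (f : I → V₁ →ₗ[ℂ] ℂ) (g : J → V₂ →ₗ[ℂ] ℂ)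
    (hf : ∀ v, (∀ i, f i v = 0) → v = 0) (hg : ∀ v, (∀ j, g j v = 0) → v = 0) (z : V₁ ⊗[ℂ] V₂)
    (h : ∀ i j, LinearMap.mul' ℂ ℂ (TensorProduct.map (f i) (g j) z) = 0) : z = 0 := by
  have h₁ : ∀ i, TensorProduct.lid ℂ V₂ ((f i).rTensor V₂ z) = 0 := by
    refine fun i => hg _ fun j => ?_
    rw [← h i j]
    clear h
    induction z with
    | zero => simp
    | tmul x y => simp
    | add x y hx hy => simp only [map_add, hx, hy]
  classical
  let b := Module.Basis.ofVectorSpace ℂ V₂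
  apply (TensorProduct.equivFinsuppOfBasisRight (M := V₁) b).injective
  rw [map_zero]
  ext k
  refine hf _ fun i => ?_
  have h₂ : f i (TensorProduct.equivFinsuppOfBasisRight (M := V₁) b z k)
      = b.coord k (TensorProduct.lid ℂ V₂ ((f i).rTensor V₂ z)) := by
    clear h h₁
    induction z with
    | zero => simp
    | tmul x y => simp [mul_comm]
    | add x y hx hy => simp only [map_add, Finsupp.add_apply, hx, hy]
  rw [h₂, h₁, map_zero]

end Separation

/-! ### The linear map `σ` representing an independence -/

section Sigma

variable {V₁ V₂ : Type u} [AddCommGroup V₁] [Module ℂ V₁] [AddCommGroup V₂] [Module ℂ V₂]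

/-- The character `S(φ₁) ⊗ S(φ₂)` of `S(V₁) ⊗ S(V₂)`. -/
def pairChar (φ₁ : V₁ →ₗ[ℂ] ℂ) (φ₂ : V₂ →ₗ[ℂ] ℂ) :
    SymmetricAlgebra ℂ V₁ ⊗[ℂ] SymmetricAlgebra ℂ V₂ →ₐ[ℂ] ℂ :=
  Algebra.TensorProduct.lift (symChar φ₁) (symChar φ₂) fun _ _ => Commute.all _ _

theorem pairChar_tmul (φ₁ : V₁ →ₗ[ℂ] ℂ) (φ₂ : V₂ →ₗ[ℂ] ℂ) (c : SymmetricAlgebra ℂ V₁)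
    (d : SymmetricAlgebra ℂ V₂) : pairChar φ₁ φ₂ (c ⊗ₜ d) = symChar φ₁ c * symChar φ₂ d := by
  simp [pairChar]

theorem pairChar_toLinearMap (φ₁ : V₁ →ₗ[ℂ] ℂ) (φ₂ : V₂ →ₗ[ℂ] ℂ) :
    (pairChar φ₁ φ₂).toLinearMap = LinearMap.mul' ℂ ℂ ∘ₗ
      TensorProduct.map (symChar φ₁).toLinearMap (symChar φ₂).toLinearMap :=
  TensorProduct.ext' fun c d => by simp [pairChar_tmul]

theorem eq_of_pairChar {z z' : SymmetricAlgebra ℂ V₁ ⊗[ℂ] SymmetricAlgebra ℂ V₂}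
    (h : ∀ φ₁ φ₂, pairChar φ₁ φ₂ z = pairChar φ₁ φ₂ z') : z = z' := by
  rw [← sub_eq_zero]
  refine tensor_eq_zero_of_separating (fun φ => (symChar φ).toLinearMap)
    (fun φ => (symChar φ).toLinearMap) eq_zero_of_symChar eq_zero_of_symChar _ fun φ₁ φ₂ => ?_
  have := congrArg (fun f => f (z - z')) (pairChar_toLinearMap φ₁ φ₂)
  rw [LinearMap.comp_apply] at this
  rw [← this]
  simp [h]

variable {A₁ A₂ : Type u}
  [NonUnitalRing A₁] [Module ℂ A₁] [IsScalarTower ℂ A₁ A₁] [SMulCommClass ℂ A₁ A₁]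
  [NonUnitalRing A₂] [Module ℂ A₂] [IsScalarTower ℂ A₂ A₂] [SMulCommClass ℂ A₂ A₂]

theorem isSigma_iff (P : Independence.{u})
    (σ : FreeProd A₁ A₂ →ₗ[ℂ] SymmetricAlgebra ℂ A₁ ⊗[ℂ] SymmetricAlgebra ℂ A₂) :
    IsSigma P σ ↔ ∀ φ₁ φ₂ x, P.prod φ₁ φ₂ x = pairChar φ₁ φ₂ (σ x) := by
  refine forall₂_congr fun φ₁ φ₂ => ?_
  rw [← LinearMap.comp_assoc, ← pairChar_toLinearMap]
  exact LinearMap.ext_iff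

theorem IsSigma.unique {P : Independence.{u}}
    {σ σ' : FreeProd A₁ A₂ →ₗ[ℂ] SymmetricAlgebra ℂ A₁ ⊗[ℂ] SymmetricAlgebra ℂ A₂}
    (h : IsSigma P σ) (h' : IsSigma P σ') : σ = σ' :=
  LinearMap.ext fun x => eq_of_pairChar fun φ₁ φ₂ => by
    rw [← (isSigma_iff P σ).1 h, ← (isSigma_iff P σ').1 h']

/-- Elements of `S(A₁) ⊗ S(A₂)` as functions of pairs of functionals. -/
def pairEval : SymmetricAlgebra ℂ A₁ ⊗[ℂ] SymmetricAlgebra ℂ A₂ →ₐ[ℂ]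
    ((A₁ →ₗ[ℂ] ℂ) × (A₂ →ₗ[ℂ] ℂ) → ℂ) :=
  AlgHom.pi fun τ => pairChar τ.1 τ.2

/-- The range is the algebra of functions generated by evaluations of both functionals, so it can
serve as `R` in `wordForm_mem`; words span the free product. -/
theorem prod_mem_range_pairEval (P : Independence.{u}) (x : FreeProd A₁ A₂) :
    (fun τ => P.prod τ.1 τ.2 x) ∈ (pairEval (A₁ := A₁) (A₂ := A₂)).range := by
  let R := (pairEval (A₁ := A₁) (A₂ := A₂)).range
  let G : UFreeProd A₁ A₂ →ₗ[ℂ] ((A₁ →ₗ[ℂ] ℂ) × (A₂ →ₗ[ℂ] ℂ) → ℂ) :=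
    LinearMap.pi fun τ => P.prod τ.1 τ.2 ∘ₗ FreeProd.proj
  have h : (⊤ : Submodule ℂ (UFreeProd A₁ A₂)) ≤ (Subalgebra.toSubmodule R).comap G := by
    rw [← UFreeProd.span_words, Submodule.span_le]
    rintro _ ⟨l, rfl⟩
    have := P.wordForm_mem R
      (fun a => ⟨SymmetricAlgebra.ι ℂ A₁ a ⊗ₜ 1, funext fun τ => by
        simp [pairEval, pairChar_tmul, symChar_ι]⟩)
      (fun b => ⟨1 ⊗ₜ SymmetricAlgebra.ι ℂ A₂ b, funext fun τ => by
        simp [pairEval, pairChar_tmul, symChar_ι]⟩) l.length l.get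
    simp only [Independence.wordForm_apply] at this
    have hl : l.map FreeProd.letter = List.ofFn fun i => FreeProd.letter (l.get i) := by
      conv_lhs => rw [← List.ofFn_get l]
      rw [List.map_ofFn]
      rfl
    rw [← hl] at this
    exact this
  have hx := h (Submodule.mem_top (x := FreeProd.val A₁ A₂ x))
  have hG : G (FreeProd.val A₁ A₂ x) = fun τ => P.prod τ.1 τ.2 x := funext fun τ => by
    change P.prod τ.1 τ.2 (FreeProd.proj _) = _
    rw [FreeProd.proj_val]
  rw [Submodule.mem_comap, hG] at hx
  exact hx

theorem exists_isSigma (P : Independence.{u}) (A₁ A₂ : Type u)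
    [NonUnitalRing A₁] [Module ℂ A₁] [IsScalarTower ℂ A₁ A₁] [SMulCommClass ℂ A₁ A₁]
    [NonUnitalRing A₂] [Module ℂ A₂] [IsScalarTower ℂ A₂ A₂] [SMulCommClass ℂ A₂ A₂] :
    ∃ σ : FreeProd A₁ A₂ →ₗ[ℂ] SymmetricAlgebra ℂ A₁ ⊗[ℂ] SymmetricAlgebra ℂ A₂, IsSigma P σ := by
  let ev := (pairEval (A₁ := A₁) (A₂ := A₂)).toLinearMap
  let G : FreeProd A₁ A₂ →ₗ[ℂ] LinearMap.range ev :=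
    (LinearMap.pi fun τ : (A₁ →ₗ[ℂ] ℂ) × (A₂ →ₗ[ℂ] ℂ) => P.prod τ.1 τ.2).codRestrict _
      fun x => prod_mem_range_pairEval P x
  -- Vector spaces are projective, so polynomial representatives can be chosen linearly in `x`.
  obtain ⟨σ, hσ⟩ := Module.projective_lifting_property ev.rangeRestrict G
    ev.surjective_rangeRestrict
  refine ⟨σ, (isSigma_iff P σ).2 fun φ₁ φ₂ x => ?_⟩
  have h := congrArg (fun f => (f x).1 (φ₁, φ₂)) hσ
  exact h.symm

/-! ### Functoriality of symmetric algebras and of σ -/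

variable {C₁ C₂ : Type u}
  [NonUnitalRing C₁] [Module ℂ C₁] [IsScalarTower ℂ C₁ C₁] [SMulCommClass ℂ C₁ C₁]
  [NonUnitalRing C₂] [Module ℂ C₂] [IsScalarTower ℂ C₂ C₂] [SMulCommClass ℂ C₂ C₂]

/-- The homomorphism `S(j)` of symmetric algebras. -/
def symMap (j : V₁ →ₗ[ℂ] V₂) : SymmetricAlgebra ℂ V₁ →ₐ[ℂ] SymmetricAlgebra ℂ V₂ :=
  SymmetricAlgebra.lift (SymmetricAlgebra.ι ℂ V₂ ∘ₗ j)

theorem symMap_ι (j : V₁ →ₗ[ℂ] V₂) (v : V₁) :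
    symMap j (SymmetricAlgebra.ι ℂ V₁ v) = SymmetricAlgebra.ι ℂ V₂ (j v) :=
  SymmetricAlgebra.lift_ι_apply _ v

theorem symChar_symMap (j : V₁ →ₗ[ℂ] V₂) (φ : V₂ →ₗ[ℂ] ℂ) (c : SymmetricAlgebra ℂ V₁) :
    symChar φ (symMap j c) = symChar (φ ∘ₗ j) c := by
  have h : (symChar φ).comp (symMap j) = symChar (φ ∘ₗ j) :=
    SymmetricAlgebra.algHom_ext (LinearMap.ext fun v => by simp [symMap_ι, symChar_ι])
  exact DFunLike.congr_fun h c

theorem pairChar_map_symMap {W₁ W₂ : Type u} [AddCommGroup W₁] [Module ℂ W₁] [AddCommGroup W₂]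
    [Module ℂ W₂] (j₁ : V₁ →ₗ[ℂ] W₁) (j₂ : V₂ →ₗ[ℂ] W₂) (φ₁ : W₁ →ₗ[ℂ] ℂ) (φ₂ : W₂ →ₗ[ℂ] ℂ)
    (z : SymmetricAlgebra ℂ V₁ ⊗[ℂ] SymmetricAlgebra ℂ V₂) :
    pairChar φ₁ φ₂ (Algebra.TensorProduct.map (symMap j₁) (symMap j₂) z)
      = pairChar (φ₁ ∘ₗ j₁) (φ₂ ∘ₗ j₂) z := by
  have h : (pairChar φ₁ φ₂).comp (Algebra.TensorProduct.map (symMap j₁) (symMap j₂))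
      = pairChar (φ₁ ∘ₗ j₁) (φ₂ ∘ₗ j₂) := by
    apply AlgHom.toLinearMap_injective
    refine TensorProduct.ext' fun c d => ?_
    simp [pairChar_tmul, symChar_symMap]
  exact DFunLike.congr_fun h z

/-- Naturality of `σ`. -/
theorem IsSigma.map {P : Independence.{u}}
    {σ : FreeProd A₁ A₂ →ₗ[ℂ] SymmetricAlgebra ℂ A₁ ⊗[ℂ] SymmetricAlgebra ℂ A₂}
    {σ' : FreeProd C₁ C₂ →ₗ[ℂ] SymmetricAlgebra ℂ C₁ ⊗[ℂ] SymmetricAlgebra ℂ C₂}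
    (h : IsSigma P σ) (h' : IsSigma P σ') (j₁ : A₁ →ₙₐ[ℂ] C₁) (j₂ : A₂ →ₙₐ[ℂ] C₂)
    (x : FreeProd A₁ A₂) :
    σ' (FreeProd.map j₁ j₂ x) = Algebra.TensorProduct.map (symMap (j₁ : A₁ →ₗ[ℂ] C₁))
      (symMap (j₂ : A₂ →ₗ[ℂ] C₂)) (σ x) :=
  eq_of_pairChar fun φ₁ φ₂ => by
    rw [pairChar_map_symMap, ← (isSigma_iff P σ').1 h', ← (isSigma_iff P σ).1 h, P.prod_comp]
    rfl

end Sigma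

/-! ### Convergence of convolution exponentials on coalgebras -/

section Coalgebra

variable {C D : Type u} [AddCommGroup C] [Module ℂ C] [AddCommGroup D] [Module ℂ D]

/-- The map `id ⊗ g : C ⊗ D → C`. -/
def sliceMap (g : D →ₗ[ℂ] ℂ) : C ⊗[ℂ] D →ₗ[ℂ] C :=
  (TensorProduct.rid ℂ C).toLinearMap ∘ₗ g.lTensor C

theorem sliceMap_tmul (g : D →ₗ[ℂ] ℂ) (x : C) (y : D) :
    sliceMap g (x ⊗ₜ[ℂ] y) = g y • x := by simp [sliceMap]

theorem mul'_map_eq (f : C →ₗ[ℂ] ℂ) (g : D →ₗ[ℂ] ℂ) :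
    LinearMap.mul' ℂ ℂ ∘ₗ TensorProduct.map f g = f ∘ₗ sliceMap g :=
  TensorProduct.ext' fun x y => by simp [sliceMap_tmul, mul_comm]

theorem exists_finiteDimensional_slice (z : C ⊗[ℂ] D) :
    ∃ W : Submodule ℂ C, FiniteDimensional ℂ W ∧ ∀ g : D →ₗ[ℂ] ℂ, sliceMap g z ∈ W := by
  induction z with
  | zero => exact ⟨⊥, inferInstance, fun g => by simp⟩
  | tmul x y =>
    refine ⟨Submodule.span ℂ {x}, inferInstance, fun g => ?_⟩
    rw [sliceMap_tmul]
    exact Submodule.smul_mem _ _ (Submodule.mem_span_singleton_self x)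
  | add x y hx hy =>
    obtain ⟨W, hW, h⟩ := hx
    obtain ⟨W', hW', h'⟩ := hy
    refine ⟨W ⊔ W', inferInstance, fun g => ?_⟩
    rw [map_add]
    exact Submodule.add_mem_sup (h g) (h' g)

/-- Coordinates on `W` turn the series into a continuous functional of an operator exponential,
which is summable. -/
theorem summable_exp_of_finiteDimensional (L : C →ₗ[ℂ] C) (δ : C →ₗ[ℂ] ℂ) (W : Submodule ℂ C)
    [FiniteDimensional ℂ W] (hW : ∀ x ∈ W, L x ∈ W) (c : C) (hc : c ∈ W) :
    Summable fun n : ℕ => (n.factorial : ℂ)⁻¹ * δ ((L ^ n) c) := by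
  let e : W ≃ₗ[ℂ] (Fin (Module.finrank ℂ W) → ℂ) := (Module.finBasis ℂ W).equivFun
  let T : (Fin (Module.finrank ℂ W) → ℂ) →L[ℂ] (Fin (Module.finrank ℂ W) → ℂ) :=
    LinearMap.toContinuousLinearMap (e.toLinearMap ∘ₗ L.restrict hW ∘ₗ e.symm.toLinearMap)
  let ℓ : (Fin (Module.finrank ℂ W) → ℂ) →L[ℂ] ℂ :=
    LinearMap.toContinuousLinearMap (δ ∘ₗ W.subtype ∘ₗ e.symm.toLinearMap)
  have hT : ∀ n : ℕ, ((e.symm ((T ^ n) (e ⟨c, hc⟩)) : W) : C) = (L ^ n) c := by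
    intro n
    induction n with
    | zero => simp
    | succ n ih =>
      rw [pow_succ', pow_succ', mul_apply_eq_comp, Module.End.mul_apply, ← ih]
      change ((e.symm (e (L.restrict hW (e.symm ((T ^ n) (e ⟨c, hc⟩))))) : W) : C) = _
      rw [LinearEquiv.symm_apply_apply]
      rfl
  have hs := NormedSpace.expSeries_summable' (𝕂 := ℂ) T
  have hs' := (ℓ.comp (ContinuousLinearMap.apply ℂ _ (e ⟨c, hc⟩))).summable hs
  refine hs'.congr fun n => ?_
  rw [map_smul, smul_eq_mul, ← hT n]
  rfl

variable {Δ : C →ₗ[ℂ] C ⊗[ℂ] C} {δ F : C →ₗ[ℂ] ℂ}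

theorem coalgPow_eq (n : ℕ) : coalgPow Δ δ F n = δ ∘ₗ ((sliceMap F ∘ₗ Δ) ^ n : Module.End ℂ C) := by
  induction n with
  | zero => rfl
  | succ n ih =>
    rw [coalgPow, ← LinearMap.comp_assoc, mul'_map_eq, ih]
    rfl

/-- By coassociativity, L = (id ⊗ F) ∘ Δ maps the right slice of Δ(c) by `g` to the slice by F ⋆ g.
Hence the slices of Δ(c) form an L-invariant space. -/
theorem sliceMap_comul_sliceMap
    (hΔ : ∀ c, TensorProduct.assoc ℂ C C C (Δ.rTensor C (Δ c)) = Δ.lTensor C (Δ c))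
    (g : C →ₗ[ℂ] ℂ) (c : C) : sliceMap F (Δ (sliceMap g (Δ c)))
      = sliceMap (LinearMap.mul' ℂ ℂ ∘ₗ TensorProduct.map F g ∘ₗ Δ) (Δ c) := by
  have h₁ : (sliceMap F ∘ₗ Δ) ∘ₗ sliceMap g
      = sliceMap (LinearMap.mul' ℂ ℂ ∘ₗ TensorProduct.map F g) ∘ₗ
        (TensorProduct.assoc ℂ C C C).toLinearMap ∘ₗ Δ.rTensor C := by
    refine TensorProduct.ext' fun x y => ?_
    simp only [LinearMap.comp_apply, sliceMap_tmul, map_smul, LinearMap.rTensor_tmul,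
      LinearEquiv.coe_coe]
    induction Δ x with
    | zero => simp
    | tmul p q => simp [sliceMap_tmul, smul_smul, mul_comm]
    | add p q hp hq => simp only [map_add, smul_add, hp, hq, TensorProduct.add_tmul]
  have h₂ := congrArg (fun f => f (Δ c)) h₁
  simp only [LinearMap.comp_apply, LinearEquiv.coe_coe, hΔ] at h₂
  rw [h₂]
  simp only [sliceMap, LinearMap.comp_apply, LinearMap.lTensor_comp_apply]

/-- In a coalgebra, convolution exponentials converge pointwise. -/
theorem exists_isCoalgExp
    (hΔ : ∀ c, TensorProduct.assoc ℂ C C C (Δ.rTensor C (Δ c)) = Δ.lTensor C (Δ c))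
    (hδ : ∀ c, sliceMap δ (Δ c) = c) : ∃ E, IsCoalgExp Δ δ F E := by
  have hs : ∀ c, Summable fun n : ℕ => (n.factorial : ℂ)⁻¹ * coalgPow Δ δ F n c := by
    intro c
    let S : (C →ₗ[ℂ] ℂ) →ₗ[ℂ] C :=
      { toFun := fun g => sliceMap g (Δ c)
        map_add' := fun g g' => by simp [sliceMap, LinearMap.lTensor_add]
        map_smul' := fun r g => by simp [sliceMap, LinearMap.lTensor_smul] }
    obtain ⟨W, hW, h⟩ := exists_finiteDimensional_slice (Δ c)
    have : FiniteDimensional ℂ (LinearMap.range S) :=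
      Submodule.finiteDimensional_of_le (S₂ := W) (by rintro _ ⟨g, rfl⟩; exact h g)
    simp only [coalgPow_eq]
    -- The counit puts `c` itself into the space of its slices.
    refine summable_exp_of_finiteDimensional _ δ (LinearMap.range S) ?_ c ⟨δ, hδ c⟩
    rintro _ ⟨g, rfl⟩
    exact ⟨_, (sliceMap_comul_sliceMap hΔ g c).symm⟩
  refine ⟨{ toFun := fun c => ∑' n : ℕ, (n.factorial : ℂ)⁻¹ * coalgPow Δ δ F n c
            map_add' := fun x y => ?_
            map_smul' := fun r x => ?_ }, fun c => (hs c).hasSum⟩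
  · rw [← (hs x).tsum_add (hs y)]
    simp only [map_add, mul_add]
  · rw [RingHom.id_apply, smul_eq_mul, ← tsum_mul_left]
    simp only [map_smul, smul_eq_mul, mul_left_comm]

theorem IsCoalgExp.unique {E E' : C →ₗ[ℂ] ℂ} (h : IsCoalgExp Δ δ F E)
    (h' : IsCoalgExp Δ δ F E') : E = E' := LinearMap.ext fun c => (h c).unique (h' c)

theorem coalgPow_comp {Δ' : D →ₗ[ℂ] D ⊗[ℂ] D} (f : D →ₗ[ℂ] C)
    (hf : TensorProduct.map f f ∘ₗ Δ' = Δ ∘ₗ f) (n : ℕ) :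
    coalgPow Δ' (δ ∘ₗ f) (F ∘ₗ f) n = coalgPow Δ δ F n ∘ₗ f := by
  induction n with
  | zero => rfl
  | succ n ih =>
    rw [coalgPow, coalgPow, ih, TensorProduct.map_comp, LinearMap.comp_assoc, hf]
    rfl

theorem IsCoalgExp.comp {Δ' : D →ₗ[ℂ] D ⊗[ℂ] D} {E : C →ₗ[ℂ] ℂ} (h : IsCoalgExp Δ δ F E)
    (f : D →ₗ[ℂ] C) (hf : TensorProduct.map f f ∘ₗ Δ' = Δ ∘ₗ f) :
    IsCoalgExp Δ' (δ ∘ₗ f) (F ∘ₗ f) (E ∘ₗ f) := fun d => by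
  simp only [coalgPow_comp f hf]
  exact h (f d)

end Coalgebra

/-! ### Convolution on dual semigroups -/

section Convolution

variable {B : Type u} [NonUnitalRing B] [Module ℂ B] [IsScalarTower ℂ B B] [SMulCommClass ℂ B B]
variable {P : Independence.{u}} {Δ : B →ₙₐ[ℂ] FreeProd B B}
  {σ : FreeProd B B →ₗ[ℂ] SymmetricAlgebra ℂ B ⊗[ℂ] SymmetricAlgebra ℂ B}

theorem symComul_ι (σ : FreeProd B B →ₗ[ℂ] SymmetricAlgebra ℂ B ⊗[ℂ] SymmetricAlgebra ℂ B)
    (Δ : B →ₙₐ[ℂ] FreeProd B B) (b : B) :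
    symComul σ Δ (SymmetricAlgebra.ι ℂ B b) = σ (Δ b) :=
  SymmetricAlgebra.lift_ι_apply _ b

/-- Two characters agreeing on generators. This dictionary turns identities for the comultiplication
into identities for ⋆. -/
theorem pairChar_symComul (hσ : IsSigma P σ) (φ₁ φ₂ : B →ₗ[ℂ] ℂ) (c : SymmetricAlgebra ℂ B) :
    pairChar φ₁ φ₂ (symComul σ Δ c) = symChar (conv P Δ φ₁ φ₂) c := by
  have h : (pairChar φ₁ φ₂).comp (symComul σ Δ) = symChar (conv P Δ φ₁ φ₂) := by
    refine SymmetricAlgebra.algHom_ext (LinearMap.ext fun b => ?_)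
    change pairChar φ₁ φ₂ (symComul σ Δ (SymmetricAlgebra.ι ℂ B b))
      = symChar _ (SymmetricAlgebra.ι ℂ B b)
    rw [symComul_ι, symChar_ι]
    exact ((isSigma_iff P σ).1 hσ φ₁ φ₂ (Δ b)).symm
  exact DFunLike.congr_fun h c

theorem symComul_coassoc (hσ : IsSigma P σ)
    (h : ∀ φ₁ φ₂ φ₃, conv P Δ (conv P Δ φ₁ φ₂) φ₃ = conv P Δ φ₁ (conv P Δ φ₂ φ₃))
    (c : SymmetricAlgebra ℂ B) :
    TensorProduct.assoc ℂ _ _ _ ((symComul σ Δ).toLinearMap.rTensor _ (symComul σ Δ c))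
      = (symComul σ Δ).toLinearMap.lTensor _ (symComul σ Δ c) := by
  rw [← sub_eq_zero]
  -- The last two tensor factors are tested jointly by pairs of functionals, so the claim reduces to
  -- associativity of ⋆.
  refine tensor_eq_zero_of_separating (fun φ => (symChar φ).toLinearMap)
    (fun τ : (B →ₗ[ℂ] ℂ) × (B →ₗ[ℂ] ℂ) => (pairChar τ.1 τ.2).toLinearMap) eq_zero_of_symChar
    (fun v hv => eq_of_pairChar fun φ₁ φ₂ => (hv (φ₁, φ₂)).trans (map_zero _).symm) _ ?_
  rintro φ₁ ⟨φ₂, φ₃⟩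
  have h₁ : (LinearMap.mul' ℂ ℂ ∘ₗ
      TensorProduct.map (symChar φ₁).toLinearMap (pairChar φ₂ φ₃).toLinearMap) ∘ₗ
      (TensorProduct.assoc ℂ _ _ _).toLinearMap ∘ₗ (symComul σ Δ).toLinearMap.rTensor _
      = (pairChar (conv P Δ φ₁ φ₂) φ₃).toLinearMap := by
    refine TensorProduct.ext' fun x y => ?_
    simp only [LinearMap.comp_apply, LinearMap.rTensor_tmul, AlgHom.toLinearMap_apply,
      LinearEquiv.coe_coe, pairChar_tmul, ← pairChar_symComul hσ]
    induction symComul σ Δ x with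
    | zero => simp
    | tmul p q => simp [pairChar_tmul, mul_assoc]
    | add p q hp hq => simp only [map_add, hp, hq, TensorProduct.add_tmul, add_mul]
  have h₂ : (LinearMap.mul' ℂ ℂ ∘ₗ
      TensorProduct.map (symChar φ₁).toLinearMap (pairChar φ₂ φ₃).toLinearMap) ∘ₗ
      (symComul σ Δ).toLinearMap.lTensor _ = (pairChar φ₁ (conv P Δ φ₂ φ₃)).toLinearMap := by
    refine TensorProduct.ext' fun x y => ?_
    simp [pairChar_tmul, pairChar_symComul hσ]
  have h₃ := congrArg (fun f => f (symComul σ Δ c)) h₁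
  have h₄ := congrArg (fun f => f (symComul σ Δ c)) h₂
  simp only [LinearMap.comp_apply, LinearEquiv.coe_coe, AlgHom.toLinearMap_apply,
    pairChar_symComul hσ] at h₃ h₄
  rw [map_sub, map_sub, h₃, h₄, h, sub_self]

theorem symComul_counit (hσ : IsSigma P σ) (h : ∀ φ, conv P Δ φ 0 = φ)
    (c : SymmetricAlgebra ℂ B) :
    sliceMap (symChar (0 : B →ₗ[ℂ] ℂ)).toLinearMap (symComul σ Δ c) = c := by
  rw [← sub_eq_zero]
  refine eq_zero_of_symChar _ fun φ => ?_
  have h₁ : (symChar φ).toLinearMap ∘ₗ sliceMap (symChar (0 : B →ₗ[ℂ] ℂ)).toLinearMap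
      = (pairChar φ 0).toLinearMap := by
    rw [← mul'_map_eq, pairChar_toLinearMap]
  have h₂ := congrArg (fun f => f (symComul σ Δ c)) h₁
  simp only [LinearMap.comp_apply, AlgHom.toLinearMap_apply, pairChar_symComul hσ, h] at h₂
  rw [map_sub, h₂, sub_self]

theorem IsConvExp.unique {ψ χ χ' : B →ₗ[ℂ] ℂ} (h : IsConvExp P Δ ψ χ)
    (h' : IsConvExp P Δ ψ χ') : χ = χ' := by
  obtain ⟨σ, E, hσ, hE, rfl⟩ := h
  obtain ⟨σ', E', hσ', hE', rfl⟩ := h'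
  obtain rfl := hσ.unique hσ'
  rw [hE.unique hE']

theorem IsConvExp.convExp_eq {ψ χ : B →ₗ[ℂ] ℂ} (h : IsConvExp P Δ ψ χ) :
    convExp P Δ ψ = χ := by
  have h' : ∃ χ, IsConvExp P Δ ψ χ := ⟨χ, h⟩
  rw [convExp, dif_pos h']
  exact h'.choose_spec.unique h

theorem symDeriv_comp_symMap {V W : Type u} [AddCommGroup V] [Module ℂ V] [AddCommGroup W]
    [Module ℂ W] (j : V →ₗ[ℂ] W) (ψ : W →ₗ[ℂ] ℂ) :
    symDeriv (ψ ∘ₗ j) = symDeriv ψ ∘ₗ (symMap j).toLinearMap := by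
  ext c
  change deriv (fun t : ℝ => symChar (t • (ψ ∘ₗ j)) c) 0
    = deriv (fun t : ℝ => symChar (t • ψ) (symMap j c)) 0
  simp only [symChar_symMap, LinearMap.smul_comp]

variable {B' : Type u} [NonUnitalRing B'] [Module ℂ B'] [IsScalarTower ℂ B' B']
  [SMulCommClass ℂ B' B']

/-- On generators this is the naturality of σ combined with `hj`. -/
theorem symComul_symMap {Δ' : B' →ₙₐ[ℂ] FreeProd B' B'}
    {σ' : FreeProd B' B' →ₗ[ℂ] SymmetricAlgebra ℂ B' ⊗[ℂ] SymmetricAlgebra ℂ B'}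
    (hσ : IsSigma P σ) (hσ' : IsSigma P σ') (j : B' →ₙₐ[ℂ] B)
    (hj : ∀ x, FreeProd.map j j (Δ' x) = Δ (j x)) :
    TensorProduct.map (symMap (j : B' →ₗ[ℂ] B)).toLinearMap (symMap (j : B' →ₗ[ℂ] B)).toLinearMap
      ∘ₗ (symComul σ' Δ').toLinearMap
      = (symComul σ Δ).toLinearMap ∘ₗ (symMap (j : B' →ₗ[ℂ] B)).toLinearMap := by
  have h : (Algebra.TensorProduct.map (symMap (j : B' →ₗ[ℂ] B)) (symMap (j : B' →ₗ[ℂ] B))).comp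
      (symComul σ' Δ') = (symComul σ Δ).comp (symMap (j : B' →ₗ[ℂ] B)) := by
    refine SymmetricAlgebra.algHom_ext (LinearMap.ext fun x => ?_)
    change Algebra.TensorProduct.map (symMap (j : B' →ₗ[ℂ] B)) (symMap (j : B' →ₗ[ℂ] B))
      (symComul σ' Δ' (SymmetricAlgebra.ι ℂ B' x))
        = symComul σ Δ (symMap (j : B' →ₗ[ℂ] B) (SymmetricAlgebra.ι ℂ B' x))
    rw [symMap_ι, symComul_ι, symComul_ι]
    change _ = σ (Δ (j x))
    rw [← hj, hσ'.map hσ]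
  exact congrArg AlgHom.toLinearMap h

/-- Convolution exponentials are compatible with homomorphisms of algebras intertwining the
comultiplications. -/
theorem IsConvExp.comp {Δ' : B' →ₙₐ[ℂ] FreeProd B' B'} {ψ χ : B →ₗ[ℂ] ℂ} (h : IsConvExp P Δ ψ χ)
    (j : B' →ₙₐ[ℂ] B) (hj : ∀ x, FreeProd.map j j (Δ' x) = Δ (j x)) :
    IsConvExp P Δ' (ψ ∘ₗ (j : B' →ₗ[ℂ] B)) (χ ∘ₗ (j : B' →ₗ[ℂ] B)) := by
  obtain ⟨σ, E, hσ, hE, rfl⟩ := h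
  -- σ exists for every algebra, and convergence is inherited from `B`, so `Δ'` need not be
  -- coassociative.
  obtain ⟨σ', hσ'⟩ := exists_isSigma P B' B'
  refine ⟨σ', E ∘ₗ (symMap (j : B' →ₗ[ℂ] B)).toLinearMap, hσ', ?_, ?_⟩
  · have hE' := hE.comp _ (symComul_symMap hσ hσ' j hj)
    rw [symDeriv_comp_symMap]
    convert hE' using 1
    ext c
    simp [symChar_symMap]
  · ext x
    simp [symMap_ι]

theorem conv_comp {Δ' : B' →ₙₐ[ℂ] FreeProd B' B'} (φ₁ φ₂ : B →ₗ[ℂ] ℂ) (j : B' →ₙₐ[ℂ] B)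
    (hj : ∀ x, FreeProd.map j j (Δ' x) = Δ (j x)) :
    conv P Δ' (φ₁ ∘ₗ (j : B' →ₗ[ℂ] B)) (φ₂ ∘ₗ (j : B' →ₗ[ℂ] B))
      = conv P Δ φ₁ φ₂ ∘ₗ (j : B' →ₗ[ℂ] B) := by
  rw [conv, P.prod_comp]
  exact LinearMap.ext fun x => congrArg (P.prod φ₁ φ₂) (hj x)

/-! ### Associativity and unit of the convolution -/

section IsDualSemigroup

variable [StarRing B] [StarModule ℂ B]

theorem IsDualSemigroup.conv_assoc (hΔ : IsDualSemigroup Δ) (φ₁ φ₂ φ₃ : B →ₗ[ℂ] ℂ) :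
    conv P Δ (conv P Δ φ₁ φ₂) φ₃ = conv P Δ φ₁ (conv P Δ φ₂ φ₃) := by
  have h₁ := P.prod_comp (P.prod φ₁ φ₂) φ₃ Δ (NonUnitalAlgHom.id ℂ B)
  have h₂ := P.prod_comp φ₁ (P.prod φ₂ φ₃) (NonUnitalAlgHom.id ℂ B) Δ
  ext b
  calc P.prod (conv P Δ φ₁ φ₂) φ₃ (Δ b)
      = P.prod (P.prod φ₁ φ₂) φ₃ (FreeProd.map Δ (NonUnitalAlgHom.id ℂ B) (Δ b)) :=
        DFunLike.congr_fun h₁ (Δ b)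
    _ = P.prod φ₁ (P.prod φ₂ φ₃) (FreeProd.map (NonUnitalAlgHom.id ℂ B) Δ (Δ b)) := by
        rw [P.prod_assoc, hΔ.coassoc]
    _ = P.prod φ₁ (conv P Δ φ₂ φ₃) (Δ b) := (DFunLike.congr_fun h₂ (Δ b)).symm

/-- The functional 0 factors through the homomorphism 0, so naturality replaces Δ by (id ∐ 0) ∘ Δ =
i₁ ∘ (id ⊔ 0) ∘ Δ = i₁. -/
theorem IsDualSemigroup.conv_zero (hΔ : IsDualSemigroup Δ) (φ : B →ₗ[ℂ] ℂ) :
    conv P Δ φ 0 = φ := by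
  have h₁ := P.prod_comp φ (0 : B →ₗ[ℂ] ℂ) (NonUnitalAlgHom.id ℂ B) (0 : B →ₙₐ[ℂ] B)
  have h₂ : FreeProd.map (NonUnitalAlgHom.id ℂ B) (0 : B →ₙₐ[ℂ] B)
      = (FreeProd.inl B B).comp
        (FreeProd.lift (NonUnitalAlgHom.id ℂ B) (0 : B →ₙₐ[ℂ] B)) :=
    FreeProd.hom_ext (fun a => by simp [FreeProd.map]) (fun b => by simp [FreeProd.map])
  ext b
  calc P.prod φ 0 (Δ b)
      = P.prod φ 0 (FreeProd.map (NonUnitalAlgHom.id ℂ B) (0 : B →ₙₐ[ℂ] B) (Δ b)) :=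
        DFunLike.congr_fun h₁ (Δ b)
    _ = φ b := by rw [h₂, NonUnitalAlgHom.comp_apply, hΔ.counit_right, P.prod_inl]

theorem IsDualSemigroup.exists_isConvExp (hΔ : IsDualSemigroup Δ) (P : Independence.{u})
    (ψ : B →ₗ[ℂ] ℂ) : ∃ χ, IsConvExp P Δ ψ χ := by
  obtain ⟨σ, hσ⟩ := exists_isSigma P B B
  obtain ⟨E, hE⟩ := exists_isCoalgExp (F := symDeriv ψ)
    (symComul_coassoc hσ hΔ.conv_assoc) (symComul_counit hσ hΔ.conv_zero)
  exact ⟨_, σ, E, hσ, hE, rfl⟩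

end IsDualSemigroup

end Convolution

/-! ### The tensor algebra of a dual semigroup -/

section TensorDual

variable {V : Type u} [AddCommGroup V] [Module ℂ V]

/-- Every element of the unital tensor algebra is a scalar plus an element of the subalgebra
generated by the vectors. -/
theorem TAlg.exists_scalar_add (x : TensorAlgebra ℂ V) : ∃ (c : ℂ) (y : TAlg V),
    y ∈ NonUnitalAlgebra.adjoin ℂ (Set.range (TAlg.ι (V := V))) ∧ x = algebraMap ℂ _ c + y.1 := by
  induction x using TensorAlgebra.induction with
  | algebraMap r => exact ⟨r, 0, zero_mem _, (add_zero _).symm⟩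
  | ι v =>
    refine ⟨0, TAlg.ι v, NonUnitalAlgebra.subset_adjoin ℂ ⟨v, rfl⟩, ?_⟩
    rw [map_zero, zero_add]
    rfl
  | mul a b ha hb =>
    obtain ⟨c, y, hy, rfl⟩ := ha
    obtain ⟨d, z, hz, rfl⟩ := hb
    refine ⟨c * d, c • z + d • y + y * z,
      add_mem (add_mem (SMulMemClass.smul_mem c hz) (SMulMemClass.smul_mem d hy))
        (mul_mem hy hz), ?_⟩
    change _ = algebraMap ℂ _ (c * d) + (c • z.1 + d • y.1 + y.1 * z.1)
    rw [mul_add, add_mul, add_mul, map_mul, Algebra.smul_def, ← Algebra.commutes d y.1,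
      Algebra.smul_def]
    abel
  | add a b ha hb =>
    obtain ⟨c, y, hy, rfl⟩ := ha
    obtain ⟨d, z, hz, rfl⟩ := hb
    refine ⟨c + d, y + z, add_mem hy hz, ?_⟩
    change _ = algebraMap ℂ _ (c + d) + (y.1 + z.1)
    rw [map_add]
    abel

theorem TAlg.adjoin_eq_top : NonUnitalAlgebra.adjoin ℂ (Set.range (TAlg.ι (V := V))) = ⊤ := by
  rw [eq_top_iff]
  intro x _
  obtain ⟨c, y, hy, h⟩ := TAlg.exists_scalar_add x.1
  have hx : TensorAlgebra.algebraMapInv x.1 = (0 : ℂ) := x.2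
  have hy' : TensorAlgebra.algebraMapInv y.1 = (0 : ℂ) := y.2
  rw [h, map_add, hy', AlgHom.commutes, add_zero] at hx
  have hc : c = 0 := hx
  rw [hc, map_zero, zero_add] at h
  rwa [show x = y from Subtype.ext h]

theorem TAlg.induction {p : TAlg V → Prop} (ι : ∀ v, p (TAlg.ι v)) (zero : p 0)
    (add : ∀ x y, p x → p y → p (x + y)) (mul : ∀ x y, p x → p y → p (x * y))
    (smul : ∀ (r : ℂ) x, p x → p (r • x)) (x : TAlg V) : p x := by
  have hx : x ∈ NonUnitalAlgebra.adjoin ℂ (Set.range (TAlg.ι (V := V))) := by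
    rw [TAlg.adjoin_eq_top]; trivial
  induction hx using NonUnitalAlgebra.adjoin_induction with
  | mem x hx =>
    obtain ⟨v, rfl⟩ := hx
    exact ι v
  | add x y _ _ hx hy => exact add x y hx hy
  | zero => exact zero
  | mul x y _ _ hx hy => exact mul x y hx hy
  | smul r x _ hx => exact smul r x hx

theorem TAlg.hom_ext {C : Type w} [NonUnitalRing C] [Module ℂ C] [IsScalarTower ℂ C C]
    [SMulCommClass ℂ C C] {f g : TAlg V →ₙₐ[ℂ] C} (h : ∀ v, f (TAlg.ι v) = g (TAlg.ι v)) :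
    f = g := by
  refine NonUnitalAlgHom.ext fun x => ?_
  induction x using TAlg.induction with
  | ι v => exact h v
  | zero => rw [map_zero, map_zero]
  | add x y hx hy => rw [map_add, map_add, hx, hy]
  | mul x y hx hy => rw [map_mul, map_mul, hx, hy]
  | smul r x hx => rw [map_smul, map_smul, hx]

variable {A₁ A₂ C D : Type u}
  [NonUnitalRing A₁] [Module ℂ A₁] [IsScalarTower ℂ A₁ A₁] [SMulCommClass ℂ A₁ A₁]
  [NonUnitalRing A₂] [Module ℂ A₂] [IsScalarTower ℂ A₂ A₂] [SMulCommClass ℂ A₂ A₂]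
  [NonUnitalRing C] [Module ℂ C] [IsScalarTower ℂ C C] [SMulCommClass ℂ C C]
  [NonUnitalRing D] [Module ℂ D] [IsScalarTower ℂ D D] [SMulCommClass ℂ D D]

/-- The unital homomorphism extending `h`. -/
def unitizationMap (h : C →ₙₐ[ℂ] D) : Unitization ℂ C →ₐ[ℂ] Unitization ℂ D :=
  Unitization.lift ((Unitization.inrNonUnitalAlgHom ℂ D).comp h)

theorem unitizationMap_inr (h : C →ₙₐ[ℂ] D) (c : C) :
    unitizationMap h (Unitization.inr c) = Unitization.inr (h c) := by
  simp [unitizationMap]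

theorem snd_unitizationMap (h : C →ₙₐ[ℂ] D) (x : Unitization ℂ C) :
    (unitizationMap h x).snd = h x.snd := by
  induction x using Unitization.ind with
  | inl_add_inr r c =>
    rw [map_add, unitizationMap_inr]
    change (unitizationMap h (algebraMap ℂ _ r) + _).snd = _
    rw [AlgHom.commutes, Unitization.algebraMap_eq_inl]
    simp

theorem unitizationMap_evalLetter_letterMul {A : Type u} [NonUnitalRing A] [Module ℂ A]
    [IsScalarTower ℂ A A] [SMulCommClass ℂ A A] (f : A →ₗ[ℂ] C) (h : C →ₙₐ[ℂ] D)
    (j : A →ₙₐ[ℂ] D) (hj : ∀ a, h (f a) = j a) (a : A) (z : A ⊗[ℂ] Unitization ℂ C) :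
    unitizationMap h (evalLetter f (letterMul _ a z))
      = Unitization.inr (j a) * unitizationMap h (evalLetter f z) := by
  induction z with
  | zero => simp
  | tmul x c =>
    change unitizationMap h (evalLetter f ((a * x) ⊗ₜ c)) = _
    rw [evalLetter_tmul, evalLetter_tmul, map_mul (unitizationMap h), map_mul (unitizationMap h),
      unitizationMap_inr, unitizationMap_inr, hj, hj, map_mul, Unitization.inr_mul, mul_assoc]
  | add x y hx hy => simp only [map_add, hx, hy, mul_add]

/-- If `h ∘ f` and `h ∘ g` are homomorphisms, then `h ∘ wordMap f g` is the homomorphism extending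
them. -/
theorem comp_wordMap (f : A₁ →ₗ[ℂ] C) (g : A₂ →ₗ[ℂ] C) (h : C →ₙₐ[ℂ] D) (j₁ : A₁ →ₙₐ[ℂ] D)
    (j₂ : A₂ →ₙₐ[ℂ] D) (h₁ : ∀ a, h (f a) = j₁ a) (h₂ : ∀ b, h (g b) = j₂ b)
    (x : FreeProd A₁ A₂) : h (wordMap f g x) = FreeProd.lift j₁ j₂ x := by
  -- `wordMap` need not be multiplicative, since it merges adjacent letters of one algebra before
  -- evaluating. After `h`, merging and evaluating separately agree; quantifying over all pending
  -- states makes this inductive.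
  have key : ∀ n : Pending A₁ A₂ C,
      unitizationMap h (evalPending f g
        (FreeProd.lift (pushLeft (C := C) g) (pushRight (C := C) f) x n))
      = Unitization.inr (FreeProd.lift j₁ j₂ x) * unitizationMap h (evalPending f g n) := by
    have hx : x ∈ NonUnitalAlgebra.adjoin ℂ
        (Set.range (FreeProd.inl A₁ A₂) ∪ Set.range (FreeProd.inr A₁ A₂)) := by
      rw [FreeProd.adjoin_eq_top]; trivial
    induction hx using NonUnitalAlgebra.adjoin_induction with
    | mem x hx =>
      rintro ⟨n, m, k⟩
      rcases hx with ⟨a, rfl⟩ | ⟨b, rfl⟩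
      · rw [FreeProd.lift_inl, FreeProd.lift_inl, pushLeft_apply]
        simp only [evalPending, LinearMap.coprod_apply, LinearMap.id_apply, map_add, map_zero,
          zero_add, add_zero, evalLetter_tmul, map_mul, unitizationMap_inr, h₁,
          unitizationMap_evalLetter_letterMul f h j₁ h₁, mul_add]
        abel
      · rw [FreeProd.lift_inr, FreeProd.lift_inr, pushRight_apply]
        simp only [evalPending, LinearMap.coprod_apply, LinearMap.id_apply, map_add, map_zero,
          zero_add, evalLetter_tmul, map_mul, unitizationMap_inr, h₂,
          unitizationMap_evalLetter_letterMul g h j₂ h₂, mul_add]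
        abel
    | add x y _ _ hx hy =>
      intro n
      simp only [map_add, LinearMap.add_apply, hx, hy, Unitization.inr_add, add_mul]
    | zero => simp
    | mul x y _ _ hx hy =>
      intro n
      simp only [map_mul, Module.End.mul_apply, hx, hy, Unitization.inr_mul, mul_assoc]
    | smul r x _ hx =>
      intro n
      simp only [map_smul, LinearMap.smul_apply, hx, Unitization.inr_smul, smul_mul_assoc]
  change h (evalPending f g _).snd = _
  rw [← snd_unitizationMap, key]
  simp [evalPending]

variable {B : Type u} [NonUnitalRing B] [Module ℂ B] [IsScalarTower ℂ B B] [SMulCommClass ℂ B B]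

theorem mulMap_ι (b : B) : mulMap B (TAlg.ι b) = b := TAlg.lift_ι _ b

/-- The multiplication map intertwines `T(Δ)` and `Δ`. -/
theorem map_mulMap_tensorComul (Δ : B →ₙₐ[ℂ] FreeProd B B) (x : TAlg B) :
    FreeProd.map (mulMap B) (mulMap B) (tensorComul Δ x) = Δ (mulMap B x) := by
  have h : (FreeProd.map (mulMap B) (mulMap B)).comp (tensorComul Δ) = Δ.comp (mulMap B) := by
    refine TAlg.hom_ext fun b => ?_
    rw [NonUnitalAlgHom.comp_apply, NonUnitalAlgHom.comp_apply, mulMap_ι, tensorComul,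
      TAlg.lift_ι]
    refine (comp_wordMap _ _ _ (FreeProd.inl B B) (FreeProd.inr B B) (fun a => ?_) (fun b => ?_)
      (Δ b)).trans ?_
    · change FreeProd.map _ _ (FreeProd.inl _ _ (TAlg.ι a)) = _
      rw [FreeProd.map, FreeProd.lift_inl, NonUnitalAlgHom.comp_apply, mulMap_ι]
    · change FreeProd.map _ _ (FreeProd.inr _ _ (TAlg.ι b)) = _
      rw [FreeProd.map, FreeProd.lift_inr, NonUnitalAlgHom.comp_apply, mulMap_ι]
    -- Relabelling and then multiplying back fixes both copies of `B`, so it is the identity on B ⊔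
    -- B.
    · have : FreeProd.lift (FreeProd.inl B B) (FreeProd.inr B B) = NonUnitalAlgHom.id ℂ _ :=
        FreeProd.hom_ext (by simp) (by simp)
      rw [this]
      rfl
  exact DFunLike.congr_fun h x

theorem mulMap_star [StarRing B] [StarModule ℂ B] (x : TAlg B) :
    mulMap B (star x) = star (mulMap B x) := by
  induction x using TAlg.induction with
  | ι b => rw [TAlg.star_ι, mulMap_ι, mulMap_ι]
  | zero => simp
  | add x y hx hy => simp only [star_add, map_add, hx, hy]
  | mul x y hx hy => simp only [star_mul, map_mul, hx, hy]
  | smul r x hx => simp only [star_smul, map_smul, hx]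

end TensorDual

end DualSemi

end

/-! ### Pulling the exponential back along the multiplication map -/

theorem mainTheorem6 {B : Type u} [NonUnitalRing B] [Module ℂ B] [IsScalarTower ℂ B B]
    [SMulCommClass ℂ B B] [StarRing B] [StarModule ℂ B]
    (P : DualSemi.Independence.{u})
    (Δ : B →ₙₐ[ℂ] DualSemi.FreeProd B B) (hΔ : DualSemi.IsDualSemigroup Δ)
    (φ₁ φ₂ ψ : B →ₗ[ℂ] ℂ) :
    -- (a)
    DualSemi.conv P (DualSemi.tensorComul Δ)
        (φ₁ ∘ₗ (DualSemi.mulMap B : DualSemi.TAlg B →ₗ[ℂ] B))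
        (φ₂ ∘ₗ (DualSemi.mulMap B : DualSemi.TAlg B →ₗ[ℂ] B))
      = DualSemi.conv P Δ φ₁ φ₂ ∘ₗ (DualSemi.mulMap B : DualSemi.TAlg B →ₗ[ℂ] B) ∧
    -- (b) both convolution exponentials are well defined, and they correspond
    (∃! χ, DualSemi.IsConvExp P Δ ψ χ) ∧
    (∃! χ, DualSemi.IsConvExp P (DualSemi.tensorComul Δ)
      (ψ ∘ₗ (DualSemi.mulMap B : DualSemi.TAlg B →ₗ[ℂ] B)) χ) ∧
    DualSemi.convExp P (DualSemi.tensorComul Δ)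
        (ψ ∘ₗ (DualSemi.mulMap B : DualSemi.TAlg B →ₗ[ℂ] B))
      = DualSemi.convExp P Δ ψ ∘ₗ (DualSemi.mulMap B : DualSemi.TAlg B →ₗ[ℂ] B) ∧
    -- (c) the kernel of `M` is a two-sided `*`-ideal, on which the exponential vanishes
    (∀ x : DualSemi.TAlg B, DualSemi.mulMap B x = 0 →
      DualSemi.mulMap B (star x) = 0 ∧
        ∀ y : DualSemi.TAlg B, DualSemi.mulMap B (y * x) = 0 ∧ DualSemi.mulMap B (x * y) = 0) ∧
    (∀ x : DualSemi.TAlg B, DualSemi.mulMap B x = 0 →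
      DualSemi.convExp P (DualSemi.tensorComul Δ)
        (ψ ∘ₗ (DualSemi.mulMap B : DualSemi.TAlg B →ₗ[ℂ] B)) x = 0) := by
  have hM := DualSemi.map_mulMap_tensorComul Δ
  obtain ⟨χ, hχ⟩ := hΔ.exists_isConvExp P ψ
  have hχ' := hχ.comp (DualSemi.mulMap B) hM
  have heq := hχ'.convExp_eq
  refine ⟨DualSemi.conv_comp φ₁ φ₂ (DualSemi.mulMap B) hM, ⟨χ, hχ, fun _ h => h.unique hχ⟩,
    ⟨_, hχ', fun _ h => h.unique hχ'⟩, by rw [heq, hχ.convExp_eq], fun x hx => ⟨?_, fun y => ?_⟩,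
    fun x hx => ?_⟩
  · rw [DualSemi.mulMap_star, hx, star_zero]
  · rw [map_mul, map_mul, hx, mul_zero, zero_mul]
    exact ⟨rfl, rfl⟩
  · rw [heq, LinearMap.comp_apply]
    change χ (DualSemi.mulMap B x) = 0
    rw [hx, map_zero]
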